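/- Two players play the game Trap on an undirected graph: a token starts at a given initial vertex, and the players alternately move it along an edge to a vertex that the token has not visited before; a player who cannot move loses. A strategy assigns a legal next move (where one exists) to each position, that is, to each pair consisting of a location of the token and a set of visited vertices. A player wins from the initial vertex if she has a strategy that results in her winning after finitely many moves whatever strategy the other player uses. If neither player has such a strategy, the game is a draw. For $d\ge 2$, the body-centered lattice $\mathbb B^d$ is the graph whose vertices are the points of $\mathbb Z^d$ whose coordinates are all even (the even vertices) or all odd (the odd vertices), with an edge between $u$ and $v$ whenever $\|u-v\|_\infty=1$. Given $p,q\in[0,1]$, each odd vertex is declared closed with probability $p$ and each even vertex is declared closed with probability $q$, independently for all vertices; vertices that are not closed are open. Trap is played on the subgraph of $\mathbb B^d$ induced by the open vertices, which is known to both players. If the initial vertex is closed, the game is declared a win for the first player. Every move goes from an even vertex to an odd one or from an odd vertex to an even one; Odin is the player who moves from even to odd vertices, and Eve is the player who moves from odd to even vertices (so Odin is the first player if the initial vertex is even, and Eve is the first player if it is odd). **Theorem.** Let $d\ge 2$ and $p\in(0,1]$. (i) If $q=0$, then almost surely, for every initial vertex of $\mathbb B^d$, Eve wins. (ii) There exists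 $q(p,d)>0$ such that for every $q\in[0,1]$ with $q<q(p,d)$, almost surely, for every initial vertex of $\mathbb B^d$, the game is not a draw. -/

import Mathlib

namespace Trap

section Game

variable {V : Type*}

/-- A position of the game: the location of the token and the set of vertices it has visited
(including its current location). -/
structure Position (V : Type*) where
  token : V
  visited : Set V

/-- A move takes the token along an edge to a vertex that has never been visited before. -/
def LegalMove (G : SimpleGraph V) (P : Position V) (w : V) : Prop :=
  G.Adj P.token w ∧ w ∉ P.visited

/-- The player to move has no possible move (and so loses). -/
def Terminal (G : SimpleGraph V) (P : Position V) : Prop :=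
  ∀ w, ¬ LegalMove G P w

/-- The position after the token has been moved to `w`. -/
def Position.move (P : Position V) (w : V) : Position V :=
  ⟨w, insert w P.visited⟩

/-- The position in which the game starts from `v`. -/
def Position.start (v : V) : Position V :=
  ⟨v, {v}⟩

/-- A strategy assigns to each position a next move, which is legal whenever a legal move exists
(its value at a terminal position is never used). -/
structure Strategy (G : SimpleGraph V) where
  next : Position V → V
  legal : ∀ P, ¬ Terminal G P → LegalMove G P (next P)

/-- The position after `n` moves if the first player uses `σ` and the second player uses `τ`.
It is meaningful as long as no earlier position is terminal. -/
def play {G : SimpleGraph V} (σ τ : Strategy G) (v : V) : ℕ → Position V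
  | 0 => Position.start v
  | n + 1 => (play σ τ v n).move
      (if Even n then σ.next (play σ τ v n) else τ.next (play σ τ v n))

/-- The game from `v` between `σ` (first player) and `τ` (second player) ends after exactly
`n` moves. -/
def EndsAfter {G : SimpleGraph V} (σ τ : Strategy G) (v : V) (n : ℕ) : Prop :=
  Terminal G (play σ τ v n) ∧ ∀ m < n, ¬ Terminal G (play σ τ v m)

/-- The first player has a winning strategy for Trap on `G` from `v`: whatever the second player
does, the game ends after an odd number of moves, with the second player unable to move. -/
def FirstWins (G : SimpleGraph V) (v : V) : Prop :=
  ∃ σ : Strategy G, ∀ τ : Strategy G, ∃ n, Odd n ∧ EndsAfter σ τ v n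

/-- The second player has a winning strategy for Trap on `G` from `v`: whatever the first player
does, the game ends after an even number of moves, with the first player unable to move. -/
def SecondWins (G : SimpleGraph V) (v : V) : Prop :=
  ∃ τ : Strategy G, ∀ σ : Strategy G, ∃ n, Even n ∧ EndsAfter σ τ v n

/-- The subgraph of `G` induced by the open vertices, where `ω v = true` means that `v` is
closed. -/
abbrev openSubgraph (G : SimpleGraph V) (ω : V → Bool) : SimpleGraph {v : V // ω v = false} :=
  G.induce {v | ω v = false}

/-- The first player wins Trap on the open subgraph from `v`. By convention this is declared to be
the case if `v` is closed. -/
def OpenFirstWins (G : SimpleGraph V) (ω : V → Bool) (v : V) : Prop :=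
  ω v = true ∨ ∃ h : ω v = false, FirstWins (openSubgraph G ω) ⟨v, h⟩

/-- The second player wins Trap on the open subgraph from `v` (so `v` must be open). -/
def OpenSecondWins (G : SimpleGraph V) (ω : V → Bool) (v : V) : Prop :=
  ∃ h : ω v = false, SecondWins (openSubgraph G ω) ⟨v, h⟩

/-- Trap on the open subgraph from `v` is a draw: neither player wins. -/
def OpenDraw (G : SimpleGraph V) (ω : V → Bool) (v : V) : Prop :=
  ¬ OpenFirstWins G ω v ∧ ¬ OpenSecondWins G ω v

end Game

section Lattice

/-- The vertices of the body-centered hypercubic lattice: the integer points whose coordinates are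
all even or all odd. -/
abbrev BVertex (d : ℕ) : Type :=
  {x : Fin d → ℤ // (∀ i, Even (x i)) ∨ (∀ i, Odd (x i))}

def IsEvenVertex {d : ℕ} (v : BVertex d) : Prop := ∀ i, Even (v.1 i)

def IsOddVertex {d : ℕ} (v : BVertex d) : Prop := ∀ i, Odd (v.1 i)

/-- The body-centered hypercubic lattice: `u` and `v` are adjacent when their difference has
supremum norm one. -/
def bodyCenteredLattice (d : ℕ) : SimpleGraph (BVertex d) where
  Adj u v := ‖u.1 - v.1‖ = 1
  symm := ⟨fun u v h => by rw [norm_sub_rev]; exact h⟩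
  loopless := ⟨fun u h => by simp at h⟩

/-- The probability with which `v` is closed: `p` for odd vertices and `q` for even ones. -/
noncomputable def closedProb {d : ℕ} (p q : unitInterval) (v : BVertex d) : unitInterval :=
  open Classical in if IsOddVertex v then p else q

/-- The law of the configuration in which the vertices are closed (`true`) independently, odd ones
with probability `p` and even ones with probability `q`. -/
noncomputable def percolation (d : ℕ) (p q : unitInterval) :
    MeasureTheory.Measure (BVertex d → Bool) :=
  MeasureTheory.Measure.infinitePi fun v =>
    ProbabilityTheory.bernoulliMeasure true false (closedProb p q v)

/-- Eve, who always moves from odd vertices to even vertices, wins from `v`: she is the first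
player if `v` is odd and the second player if `v` is even. -/
def EveWins {d : ℕ} (ω : BVertex d → Bool) (v : BVertex d) : Prop :=
  (IsOddVertex v ∧ OpenFirstWins (bodyCenteredLattice d) ω v) ∨
    (IsEvenVertex v ∧ OpenSecondWins (bodyCenteredLattice d) ω v)

/-- Trap on the open subgraph of the body-centered lattice from `v` is a draw. -/
def IsDraw {d : ℕ} (ω : BVertex d → Bool) (v : BVertex d) : Prop :=
  OpenDraw (bodyCenteredLattice d) ω v

end Lattice

end Trap

/-! Eve owns a trap once the open odd neighbours of a finite set `A` of open even vertices are
matched injectively into `A`: whenever the token comes next to `A` she answers along the matching,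
Odin can only move back into the neighbourhood of `A`, and he runs out of moves first. A cube of
even vertices of side `n` has `n ^ d` points and `(n + 1) ^ d` odd neighbours, an excess of surface
order, whereas a positive fraction of these neighbours is closed. Large cubes should therefore be
traps (`Good`), apart from openness of their even vertices.

The probabilistic core, `cubesLikelyGood`, is an induction on the dimension. Attaching a layer of
even vertices to a face of a good box creates new odd neighbours in one parallel layer only, and
matching these is the same problem one dimension lower. By induction such layers are good except
with probability smaller than any power of the side. A closed seed then grows to any size with
probability bounded below, and among many disjoint smaller cubes in a large one some cube is good
and grows to fill it.

If `q = 0`, all even vertices are open, and good cubes near the initial vertex give Eve her win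
(`ae_eveWins`). If `q` is small, the lattice is cut into large blocks, each of which is a trap with
open even vertices with probability near one. A path-counting argument makes clusters of bad blocks
finite (`ae_finite_cluster`). The blocks around such a cluster are good, and good sets are closed
under union, so they form one trap around a finite region. Whoever leaves the region into the
neighbourhood of the trap loses, so the game inside is in effect finite and hence determined. -/

namespace Trap

open MeasureTheory ProbabilityTheory

/-! ### Forced wins, traps and determinacy -/

section GameValue

variable {V : Type*} {G : SimpleGraph V}

/-- `Forced G n true P` means that the player to move at `P` can force a win within `n` moves,
and `Forced G n false P` that the opponent can. -/
def Forced (G : SimpleGraph V) : ℕ → Bool → Position V → Prop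
  | 0, b, P => b = false ∧ Terminal G P
  | n + 1, true, P => ∃ w, LegalMove G P w ∧ Forced G n false (P.move w)
  | n + 1, false, P => ∀ w, LegalMove G P w → Forced G n true (P.move w)

lemma Forced.succ {n : ℕ} {b : Bool} {P : Position V} (h : Forced G n b P) :
    Forced G (n + 1) b P := by
  induction n generalizing b P with
  | zero =>
    obtain ⟨rfl, h⟩ := h
    exact fun w hw => (h w hw).elim
  | succ n ih =>
    cases b with
    | true =>
      obtain ⟨w, hw, h⟩ := h
      exact ⟨w, hw, ih h⟩
    | false => exact fun w hw => ih (h w hw)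

lemma Forced.mono {m n : ℕ} (hmn : m ≤ n) {b : Bool} {P : Position V} (h : Forced G m b P) :
    Forced G n b P := by
  induction n, hmn using Nat.le_induction with
  | base => exact h
  | succ n _ ih => exact ih.succ

-- A strategy sees the position but not the number of moves within which a win was promised. The
-- move attaining the least bound serves every valid bound at once, and strict decrease of the bound
-- rules out infinite play.
open Classical in
lemma exists_fastest_move {P : Position V} (h : ∃ n, Forced G n true P) :
    ∃ w, LegalMove G P w ∧ ∀ n, Forced G n true P → ∃ m < n, Forced G m false (P.move w) := by
  have hs := Nat.find_spec h
  have hmin : ∀ n, Forced G n true P → Nat.find h ≤ n := fun n hn => Nat.find_min' h hn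
  generalize Nat.find h = k at hs hmin
  cases k with
  | zero => simp [Forced] at hs
  | succ k =>
    obtain ⟨w, hw, h'⟩ := hs
    exact ⟨w, hw, fun n hn => ⟨k, hmin n hn, h'⟩⟩

open Classical in
/-- The strategy that plays for the fastest forced win whenever there is one. -/
noncomputable def forcingStrategy (G : SimpleGraph V) : Strategy G where
  next P :=
    if h : ∃ n, Forced G n true P then (exists_fastest_move h).choose
    else if h' : ∃ w, LegalMove G P w then h'.choose else P.token
  legal P hP := by
    have h' : ∃ w, LegalMove G P w := by simpa [Terminal] using hP
    by_cases h : ∃ n, Forced G n true P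
    · simpa only [h, dif_pos] using (exists_fastest_move h).choose_spec.1
    · simpa only [h, h', dif_pos, dif_neg, not_false_iff] using h'.choose_spec

lemma forcingStrategy_spec {n : ℕ} {P : Position V} (h : Forced G n true P) :
    ∃ m < n, Forced G m false (P.move ((forcingStrategy G).next P)) := by
  have h' : ∃ n, Forced G n true P := ⟨n, h⟩
  simpa only [forcingStrategy, h', dif_pos] using (exists_fastest_move h').choose_spec.2 n h

/-- If one player follows the forcing strategy at her turns and the opponent moves legally, then
a forced win for her is realised. -/
lemma Forced.exists_terminal {Q : ℕ → Position V} {turn : ℕ → Prop}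
    (hturn : ∀ n, turn (n + 1) ↔ ¬ turn n)
    (hwin : ∀ n, turn n → Q (n + 1) = (Q n).move ((forcingStrategy G).next (Q n)))
    (hlose : ∀ n, ¬ turn n → ¬ Terminal G (Q n) →
      ∃ w, LegalMove G (Q n) w ∧ Q (n + 1) = (Q n).move w) {n : ℕ} :
    ∀ {b : Bool} {k : ℕ}, Forced G n b (Q k) → (b = true ↔ turn k) →
      (∀ m < k, ¬ Terminal G (Q m)) →
      ∃ k, ¬ turn k ∧ Terminal G (Q k) ∧ ∀ m < k, ¬ Terminal G (Q m) := by
  induction n using Nat.strong_induction_on with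
  | _ n ih =>
  intro b k h hb hk
  have hstep : ¬ Terminal G (Q k) → ∀ m < k + 1, ¬ Terminal G (Q m) := fun hT m hm => by
    rcases Nat.lt_succ_iff_lt_or_eq.mp hm with hm | rfl
    exacts [hk m hm, hT]
  cases b with
  | true =>
    have ht : turn k := hb.mp rfl
    have hT : ¬ Terminal G (Q k) := by
      cases n with
      | zero => simp [Forced] at h
      | succ n =>
        obtain ⟨w, hw, -⟩ := h
        exact fun hT => hT w hw
    obtain ⟨m, hm, hf⟩ := forcingStrategy_spec h
    rw [← hwin k ht] at hf
    exact ih m hm hf (by simp [hturn, ht]) (hstep hT)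
  | false =>
    have ht : ¬ turn k := fun h' => by simpa using hb.mpr h'
    by_cases hT : Terminal G (Q k)
    · exact ⟨k, ht, hT, hk⟩
    · obtain ⟨w, hw, hQ⟩ := hlose k ht hT
      cases n with
      | zero => exact (hT h.2).elim
      | succ n =>
        have hf := h w hw
        rw [← hQ] at hf
        exact ih n n.lt_succ_self hf (by simp [hturn, ht]) (hstep hT)

lemma Forced.firstWins {n : ℕ} {v : V} (h : Forced G n true (Position.start v)) :
    FirstWins G v := by
  refine ⟨forcingStrategy G, fun τ => ?_⟩
  obtain ⟨k, hk, hT⟩ := Forced.exists_terminal (Q := play (forcingStrategy G) τ v) (turn := Even)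
    (k := 0) (fun n => Nat.even_add_one) (fun n hn => by simp [play, hn])
    (fun n hn hT => ⟨_, τ.legal _ hT, by simp [play, hn]⟩) h (by simp) (by simp)
  exact ⟨k, Nat.not_even_iff_odd.mp hk, hT⟩

lemma Forced.secondWins {n : ℕ} {v : V} (h : Forced G n false (Position.start v)) :
    SecondWins G v := by
  refine ⟨forcingStrategy G, fun σ => ?_⟩
  obtain ⟨k, hk, hT⟩ := Forced.exists_terminal (Q := play σ (forcingStrategy G) v) (turn := Odd)
    (k := 0) (fun n => by simp [Nat.odd_add_one])
    (fun n hn => by simp [play, Nat.not_even_iff_odd.mpr hn])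
    (fun n hn hT => ⟨_, σ.legal _ hT, by simp [play, Nat.not_odd_iff_even.mp hn]⟩) h (by simp)
    (by simp)
  exact ⟨k, Nat.not_odd_iff_even.mp hk, hT⟩

/-- A trap: every neighbour of the finite set `A` is matched with a vertex of `A`, so that a
player whose opponent enters the neighbourhood of `A` wins by following the matching. -/
structure IsTrap (G : SimpleGraph V) (A : Finset V) (M : V → V) : Prop where
  mem : ∀ ⦃o⦄, (∃ a ∈ A, G.Adj a o) → M o ∈ A
  adj : ∀ ⦃o⦄, (∃ a ∈ A, G.Adj a o) → G.Adj o (M o)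
  inj : Set.InjOn M {o | ∃ a ∈ A, G.Adj a o}
  indep : ∀ a ∈ A, ∀ b ∈ A, ¬ G.Adj a b

-- The invariant is that a visited vertex of `A` has its matched partner visited as well. If the
-- opponent steps to a new `w`, then `M w` is unvisited: otherwise its visited partner would be `w`
-- by injectivity. Replying `M w` restores the invariant and uses up a vertex of `A`.
open Classical in
lemma IsTrap.forced_false {A : Finset V} {M : V → V} (hA : IsTrap G A M) :
    ∀ (n : ℕ) (P : Position V), P.token ∈ A →
      (∀ a ∈ A, a ∈ P.visited → ∃ o ∈ P.visited, (∃ a ∈ A, G.Adj a o) ∧ M o = a) →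
      (A.filter (· ∉ P.visited)).card ≤ n → Forced G (2 * n + 1) false P := by
  intro n
  induction n with
  | zero =>
    intro P hP hv hn w hw
    exfalso
    have hN : ∃ a ∈ A, G.Adj a w := ⟨_, hP, hw.1⟩
    have hMv : M w ∈ P.visited := by
      by_contra hcon
      have : M w ∈ A.filter (· ∉ P.visited) := by simp [hA.mem hN, hcon]
      rw [Nat.le_zero, Finset.card_eq_zero] at hn
      simp [hn] at this
    obtain ⟨o, ho, hoN, hMo⟩ := hv _ (hA.mem hN) hMv
    exact hw.2 (hA.inj hoN hN hMo ▸ ho)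
  | succ n ih =>
    intro P hP hv hn w hw
    have hN : ∃ a ∈ A, G.Adj a w := ⟨_, hP, hw.1⟩
    have hwA : w ∉ A := fun h => hA.indep _ hP _ h hw.1
    have hMv : M w ∉ P.visited := fun hMv => by
      obtain ⟨o, ho, hoN, hMo⟩ := hv _ (hA.mem hN) hMv
      exact hw.2 (hA.inj hoN hN hMo ▸ ho)
    have hMw : M w ≠ w := fun h => hwA (h ▸ hA.mem hN)
    refine ⟨M w, ⟨hA.adj hN, by simp [Position.move, hMv, hMw]⟩, ih _ (hA.mem hN) ?_ ?_⟩
    · intro a ha hav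
      simp only [Position.move, Set.mem_insert_iff] at hav
      rcases hav with rfl | rfl | hav
      · exact ⟨w, by simp [Position.move], hN, rfl⟩
      · exact (hwA ha).elim
      · obtain ⟨o, ho, h⟩ := hv a ha hav
        exact ⟨o, by simp [Position.move, ho], h⟩
    · refine Nat.lt_succ_iff.mp (lt_of_lt_of_le (Finset.card_lt_card ?_) hn)
      refine Finset.ssubset_iff_of_subset (fun a ha => ?_) |>.mpr
        ⟨M w, by simp [hA.mem hN, hMv], by simp [Position.move]⟩
      simp only [Position.move, Finset.mem_filter, Set.mem_insert_iff, not_or] at ha ⊢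
      exact ⟨ha.1, ha.2.2.2⟩

lemma IsTrap.forced_true {A : Finset V} {M : V → V} (hA : IsTrap G A M) {P : Position V}
    (hP : ∃ a ∈ A, G.Adj a P.token) (htok : P.token ∈ P.visited) (hv : ∀ a ∈ A, a ∉ P.visited) :
    Forced G (2 * A.card + 2) true P := by
  classical
  refine ⟨M P.token, ⟨hA.adj hP, hv _ (hA.mem hP)⟩,
    hA.forced_false A.card _ (hA.mem hP) (fun a ha hav => ?_) (Finset.card_filter_le _ _)⟩
  rcases Set.mem_insert_iff.mp hav with rfl | hav
  · exact ⟨P.token, Set.mem_insert_of_mem _ htok, hP, rfl⟩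
  · exact (hv a ha hav).elim

open Classical in
/-- In a finite region that can only be left through the neighbourhood of a trap, the game is
determined. -/
lemma IsTrap.determined {A : Finset V} {M : V → V} (hA : IsTrap G A M) {I : Finset V}
    (hI : ∀ x ∈ I, ∀ y, G.Adj x y → y ∈ I ∨ ∃ a ∈ A, G.Adj a y)
    (hAI : Disjoint A I) (n : ℕ) :
    ∀ P : Position V, P.token ∈ I → P.visited ⊆ I →
      (I.filter (· ∉ P.visited)).card ≤ n →
      ∃ b, Forced G (n + 2 * A.card + 3) b P := by
  classical
  -- Leaving `I` loses at once, whichever player does it: the trap is still untouched and the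
  -- opponent is on move next to it. Only moves inside the finite set `I` remain to be analysed.
  have hexit : ∀ (P : Position V) w, P.token ∈ I → P.visited ⊆ I → LegalMove G P w → w ∉ I →
      Forced G (2 * A.card + 2) true (P.move w) := by
    intro P w hP hv hw hwI
    have hN := (hI _ hP _ hw.1).resolve_left hwI
    refine hA.forced_true hN (by simp [Position.move]) (fun a ha hav => ?_)
    rcases Set.mem_insert_iff.mp hav with rfl | hav
    · obtain ⟨b, hb, hab⟩ := hN
      exact hA.indep b hb _ ha hab
    · exact Finset.disjoint_left.mp hAI ha (by simpa using hv hav)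
  induction n with
  | zero =>
    intro P hP hv hn
    refine ⟨false, Forced.mono (m := 2 * A.card + 2 + 1) (by omega) fun w hw => ?_⟩
    refine hexit P w hP hv hw fun hwI => ?_
    rw [Nat.le_zero, Finset.card_eq_zero] at hn
    have : w ∈ I.filter (· ∉ P.visited) := by simp [hwI, hw.2]
    simp [hn] at this
  | succ n ih =>
    intro P hP hv hn
    have key : ∀ w, LegalMove G P w → w ∈ I →
        ∃ b, Forced G (n + 2 * A.card + 3) b (P.move w) := by
      intro w hw hwI
      refine ih _ hwI (Set.insert_subset (by simpa using hwI) hv) ?_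
      refine Nat.lt_succ_iff.mp (lt_of_lt_of_le (Finset.card_lt_card ?_) hn)
      refine Finset.ssubset_iff_of_subset (fun a ha => ?_) |>.mpr
        ⟨w, by simp [hwI, hw.2], by simp [Position.move]⟩
      simp only [Position.move, Finset.mem_filter, Set.mem_insert_iff, not_or] at ha ⊢
      exact ⟨ha.1, ha.2.2⟩
    by_cases hw : ∃ w, LegalMove G P w ∧ Forced G (n + 2 * A.card + 3) false (P.move w)
    · exact ⟨true, Forced.mono (m := n + 2 * A.card + 3 + 1) (by omega) hw⟩
    · refine ⟨false, Forced.mono (m := n + 2 * A.card + 3 + 1) (by omega) fun w hl => ?_⟩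
      by_cases hwI : w ∈ I
      · obtain ⟨b, hb⟩ := key w hl hwI
        cases b with
        | true => exact hb
        | false => exact (hw ⟨w, hl, hb⟩).elim
      · exact (hexit P w hP hv hl hwI).mono (by omega)

end GameValue

/-! ### Good sets of even vertices and their unions -/

section Good

/-- In the coordinates `x ↦ 2 x` for even and `y ↦ 2 y - 1` for odd vertices, adjacency of the
even vertex `x` and the odd vertex `y`. -/
def Touch {d : ℕ} (x y : Fin d → ℤ) : Prop := ∀ i, x i ≤ y i ∧ y i ≤ x i + 1

/-- The odd vertices adjacent to the set `A` of even vertices. -/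
def nbhd {d : ℕ} (A : Set (Fin d → ℤ)) : Set (Fin d → ℤ) := {y | ∃ x ∈ A, Touch x y}

/-- The odd neighbours of `A` that are not closed in `C` can be matched with vertices of `A`. -/
def Good {d : ℕ} (C : (Fin d → ℤ) → Bool) (A : Set (Fin d → ℤ)) : Prop :=
  ∃ M : (Fin d → ℤ) → (Fin d → ℤ), (∀ y ∈ nbhd A, C y = false → M y ∈ A ∧ Touch (M y) y) ∧
    Set.InjOn M {y | y ∈ nbhd A ∧ C y = false}

variable {d : ℕ} {C C' : (Fin d → ℤ) → Bool} {A B : Set (Fin d → ℤ)}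

lemma nbhd_union : nbhd (A ∪ B) = nbhd A ∪ nbhd B := by
  ext y
  simp [nbhd, or_and_right, exists_or]

lemma Good.congr (h : ∀ y ∈ nbhd A, C y = C' y) (hA : Good C A) :
    Good C' A := by
  obtain ⟨M, h1, h2⟩ := hA
  refine ⟨M, fun y hy hC => h1 y hy (by rw [h y hy, hC]), h2.mono ?_⟩
  rintro y ⟨hy, hC⟩
  exact ⟨hy, by rw [h y hy, hC]⟩

lemma good_congr (h : ∀ y ∈ nbhd A, C y = C' y) : Good C A ↔ Good C' A :=
  ⟨Good.congr h, Good.congr fun y hy => (h y hy).symm⟩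

lemma good_of_closed (h : ∀ y ∈ nbhd A, C y = true) : Good C A :=
  by
  refine ⟨id, fun y hy hC => by simp [h y hy] at hC, fun y hy => ?_⟩
  have := h y hy.1
  simp [hy.2] at this

lemma good_empty : Good C ∅ := by
  refine good_of_closed fun y hy => ?_
  obtain ⟨_, hx, _⟩ := hy
  exact hx.elim

/-- A matching of the neighbourhood of `A` is extended by a matching of the remaining vertices
with vertices outside `A`. -/
lemma Good.extend (hA : Good C A) {L : Set (Fin d → ℤ)} {M : (Fin d → ℤ) → (Fin d → ℤ)}
    (hM : ∀ y ∈ nbhd L \ nbhd A, C y = false → M y ∈ L \ A ∧ Touch (M y) y)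
    (hinj : Set.InjOn M {y | y ∈ nbhd L \ nbhd A ∧ C y = false}) : Good C (A ∪ L) := by
  classical
  obtain ⟨K, h1, h2⟩ := hA
  refine ⟨fun y => if y ∈ nbhd A then K y else M y, fun y hy hC => ?_, ?_⟩
  · rw [nbhd_union] at hy
    by_cases h : y ∈ nbhd A
    · simpa [h] using ⟨Or.inl (h1 y h hC).1, (h1 y h hC).2⟩
    · have := hM y ⟨hy.resolve_left h, h⟩ hC
      simpa [h] using ⟨Or.inr this.1.1, this.2⟩
  · rintro y ⟨hy, hC⟩ z ⟨hz, hC'⟩ hyz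
    rw [nbhd_union] at hy hz
    by_cases h : y ∈ nbhd A <;> by_cases h' : z ∈ nbhd A <;>
      simp only [h, h', if_true, if_false] at hyz
    · exact h2 ⟨h, hC⟩ ⟨h', hC'⟩ hyz
    · exact ((hM z ⟨hz.resolve_left h', h'⟩ hC').1.2 (hyz ▸ (h1 y h hC).1)).elim
    · exact ((hM y ⟨hy.resolve_left h, h⟩ hC).1.2 (hyz ▸ (h1 z h' hC').1)).elim
    · exact hinj ⟨⟨hy.resolve_left h, h⟩, hC⟩ ⟨⟨hz.resolve_left h', h'⟩, hC'⟩ hyz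

/-- The matching of `A` takes precedence, and that of `B` serves the neighbours not adjacent to `A`.
No partner is used twice: such a neighbour touches its partner, so the partner cannot lie in `A`. -/
lemma Good.union (hA : Good C A) (hB : Good C B) : Good C (A ∪ B) := by
  obtain ⟨M, h1, h2⟩ := hB
  refine hA.extend (M := M) (fun y hy hC => ⟨⟨(h1 y hy.1 hC).1, fun h => ?_⟩, (h1 y hy.1 hC).2⟩)
    (h2.mono ?_)
  swap
  · rintro y ⟨hy, hC⟩
    exact ⟨hy.1, hC⟩
  exact hy.2 ⟨_, h, (h1 y hy.1 hC).2⟩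

lemma Good.biUnion {κ : Type*} (T : Finset κ) {A : κ → Set (Fin d → ℤ)}
    (h : ∀ t ∈ T, Good C (A t)) : Good C (⋃ t ∈ T, A t) := by
  classical
  induction T using Finset.induction_on with
  | empty => simpa using good_empty
  | insert a s _ ih =>
    rw [Finset.set_biUnion_insert]
    exact (h a (by simp)).union (ih fun t ht => h t (by simp [ht]))

/-- The half-open box of even vertices between `a` and `b`. -/
def Box (a b : Fin d → ℤ) : Set (Fin d → ℤ) := {x | ∀ i, a i ≤ x i ∧ x i < b i}

lemma nbhd_box_subset (a b : Fin d → ℤ) : nbhd (Box a b) ⊆ Set.Icc a b := by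
  rintro y ⟨x, hx, hxy⟩
  rw [Set.mem_Icc, Pi.le_def, Pi.le_def]
  refine ⟨fun i => ?_, fun i => ?_⟩ <;> have := hx i <;> have := hxy i <;> omega

lemma nbhd_box {a b : Fin d → ℤ} (h : ∀ i, a i < b i) : nbhd (Box a b) = Set.Icc a b := by
  refine (nbhd_box_subset a b).antisymm fun y hy => ?_
  rw [Set.mem_Icc, Pi.le_def, Pi.le_def] at hy
  -- An odd vertex on the top face has no even vertex of the half-open box at its own coordinate, so
  -- the one below it is taken.
  refine ⟨fun i => if y i = b i then y i - 1 else y i, fun i => ?_, fun i => ?_⟩ <;>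
    have h1 := hy.1 i <;> have h2 := hy.2 i <;> have h3 := h i <;> dsimp only <;> split_ifs <;>
    omega

/-- The cube of even vertices with lower corner `a` and side `n`. -/
def Cube (a : Fin d → ℤ) (n : ℕ) : Set (Fin d → ℤ) := Box a (fun i => a i + n)

lemma good_box_of_cubes {a b : Fin d → ℤ} {m : ℕ} (hm : 0 < m) (hab : ∀ i, a i + m ≤ b i)
    (h : ∀ c : Fin d → ℤ, (∀ i, a i ≤ c i) → (∀ i, c i + m ≤ b i) → Good C (Cube c m)) :
    Good C (Box a b) := by
  have : Box a b = ⋃ c ∈ Finset.Icc a (fun i => b i - m), Cube c m := by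
    ext x
    simp only [Set.mem_iUnion, Finset.mem_Icc, exists_prop, Pi.le_def]
    constructor
    · intro hx
      -- The cube cornered at `x` is pushed back where it would stick out of the box.
      refine ⟨fun i => min (x i) (b i - m), ⟨fun i => ?_, fun i => ?_⟩, fun i => ?_⟩ <;>
        have := hx i <;> have := hab i <;> dsimp only <;> omega
    · rintro ⟨c, ⟨h1, h2⟩, h3⟩ i
      have := h1 i; have := h2 i; have := h3 i
      dsimp only at *
      omega
  rw [this]
  refine Good.biUnion _ fun c hc => ?_
  rw [Finset.mem_Icc] at hc
  exact h c hc.1 fun i => by have := hc.2 i; dsimp only at this; omega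

end Good

/-! ### Growing a good box layer by layer -/

section Growth

variable {d : ℕ} {C : (Fin (d + 1) → ℤ) → Bool}

/-- The configuration in the layer with `i`-th coordinate `t`. -/
def slice (C : (Fin (d + 1) → ℤ) → Bool) (i : Fin (d + 1)) (t : ℤ) : (Fin d → ℤ) → Bool :=
  fun y => C (i.insertNth t y)

/-- The unmatched neighbours all lie in the odd layer at height `t`, and for `t = s` or `t = s + 1`
adjacency between that layer and the even layer at height `s` is adjacency in dimension `d`. The
matching of `B` therefore lifts, with values outside `A`. -/
lemma Good.add_layer {A : Set (Fin (d + 1) → ℤ)} (hA : Good C A) {i : Fin (d + 1)} {s t : ℤ}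
    (hst : s ≤ t ∧ t ≤ s + 1) {B : Set (Fin d → ℤ)} (hB : Good (slice C i t) B)
    (hdisj : ∀ x ∈ A, x i ≠ s)
    (ht : ∀ y ∈ nbhd {x : Fin (d + 1) → ℤ | x i = s ∧ i.removeNth x ∈ B}, y ∉ nbhd A → y i = t) :
    Good C (A ∪ {x | x i = s ∧ i.removeNth x ∈ B}) := by
  obtain ⟨M, h1, h2⟩ := hB
  have hy : ∀ y ∈ nbhd {x : Fin (d + 1) → ℤ | x i = s ∧ i.removeNth x ∈ B} \ nbhd A,
      C y = false → y i = t ∧ i.removeNth y ∈ nbhd B ∧ slice C i t (i.removeNth y) = false := by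
    rintro y ⟨hy, hyA⟩ hC
    have hyt := ht y hy hyA
    obtain ⟨x, hx, hxy⟩ := hy
    refine ⟨hyt, ⟨_, hx.2, fun j => hxy _⟩, ?_⟩
    rw [slice, ← hyt, Fin.insertNth_self_removeNth, hC]
  refine hA.extend (M := fun y => i.insertNth s (M (i.removeNth y))) (fun y hyL hC => ?_) ?_
  · obtain ⟨hyt, hyB, hyC⟩ := hy y hyL hC
    obtain ⟨h3, h4⟩ := h1 _ hyB hyC
    refine ⟨⟨⟨by simp, by simpa using h3⟩, fun hx => hdisj _ hx (by simp)⟩, fun j => ?_⟩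
    induction j using i.succAboveCases with
    | x => simpa [hyt] using hst
    | p j => simpa [Fin.removeNth] using h4 j
  · rintro y ⟨hyL, hC⟩ z ⟨hzL, hC'⟩ hyz
    obtain ⟨hyt, hyB, hyC⟩ := hy y hyL hC
    obtain ⟨hzt, hzB, hzC⟩ := hy z hzL hC'
    have := h2 ⟨hyB, hyC⟩ ⟨hzB, hzC⟩ (Fin.insertNth_right_injective (α := fun _ => ℤ) s hyz)
    rw [← Fin.insertNth_self_removeNth i y, ← Fin.insertNth_self_removeNth i z, this, hyt, hzt]

lemma mem_box_iff_removeNth {a b x : Fin (d + 1) → ℤ} (i : Fin (d + 1)) :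
    x ∈ Box a b ↔ (a i ≤ x i ∧ x i < b i) ∧ i.removeNth x ∈ Box (i.removeNth a) (i.removeNth b) :=
  Fin.forall_iff_succAbove i

/-- The new even layer has height `b i`. Its odd neighbours at height `b i` already belong to the
old neighbourhood `Icc a b`, which leaves those at height `b i + 1`. -/
lemma Good.box_add_top {a b : Fin (d + 1) → ℤ} (hab : ∀ i, a i < b i) (h : Good C (Box a b))
    (i : Fin (d + 1))
    (hs : Good (slice C i (b i + 1)) (Box (i.removeNth a) (i.removeNth b))) :
    Good C (Box a (Function.update b i (b i + 1))) := by
  have := h.add_layer (i := i) (s := b i) (t := b i + 1) (by omega) hs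
    (fun x hx => (hx i).2.ne) ?_
  · convert this using 1
    ext x
    have hr : i.removeNth (Function.update b i (b i + 1)) = i.removeNth b := by
      ext j; simp [Fin.removeNth]
    simp only [Set.mem_union, Set.mem_ofPred_eq, mem_box_iff_removeNth i, hr,
      Function.update_self]
    have := hab i
    rw [← or_and_right]
    refine and_congr_left fun _ => ?_
    omega
  · rintro y ⟨x, ⟨hxi, hx⟩, hxy⟩ hyA
    rw [nbhd_box hab] at hyA
    have hyi := hxy i
    by_contra hne
    refine hyA ?_
    have key : ∀ j, a j ≤ y j ∧ y j ≤ b j := by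
      rw [Fin.forall_iff_succAbove i]
      have := hab i
      refine ⟨by omega, fun j => ?_⟩
      have h1 := hx j
      have h2 := hxy (i.succAbove j)
      simp only [Fin.removeNth] at h1
      omega
    exact ⟨fun j => (key j).1, fun j => (key j).2⟩

lemma Good.box_add_bottom {a b : Fin (d + 1) → ℤ} (hab : ∀ i, a i < b i) (h : Good C (Box a b))
    (i : Fin (d + 1))
    (hs : Good (slice C i (a i - 1)) (Box (i.removeNth a) (i.removeNth b))) :
    Good C (Box (Function.update a i (a i - 1)) b) := by
  have := h.add_layer (i := i) (s := a i - 1) (t := a i - 1) (by omega) hs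
    (fun x hx => by have := hx i; omega) ?_
  · convert this using 1
    ext x
    have hr : i.removeNth (Function.update a i (a i - 1)) = i.removeNth a := by
      ext j; simp [Fin.removeNth]
    simp only [Set.mem_union, Set.mem_ofPred_eq, mem_box_iff_removeNth i, hr,
      Function.update_self]
    have := hab i
    rw [← or_and_right]
    refine and_congr_left fun _ => ?_
    omega
  · rintro y ⟨x, ⟨hxi, hx⟩, hxy⟩ hyA
    rw [nbhd_box hab] at hyA
    have hyi := hxy i
    by_contra hne
    refine hyA ?_
    have key : ∀ j, a j ≤ y j ∧ y j ≤ b j := by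
      rw [Fin.forall_iff_succAbove i]
      have := hab i
      refine ⟨by omega, fun j => ?_⟩
      have h1 := hx j
      have h2 := hxy (i.succAbove j)
      simp only [Fin.removeNth] at h1
      omega
    exact ⟨fun j => (key j).1, fun j => (key j).2⟩

/-- All cubes of side `m` in the layers of the box from `lo` to `hi` that do not meet the box from
`a` to `b` are good. -/
def SlicesGood (C : (Fin (d + 1) → ℤ) → Bool) (lo hi a b : Fin (d + 1) → ℤ) (m : ℕ) : Prop :=
  ∀ i t, lo i ≤ t → t ≤ hi i → (t < a i ∨ b i < t) → ∀ c : Fin d → ℤ,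
    (∀ j, i.removeNth lo j ≤ c j) → (∀ j, c j + m ≤ i.removeNth hi j) →
    Good (slice C i t) (Cube c m)

/-- A good box grows until it fills the surrounding box if the layers are good. -/
lemma Good.grow {lo hi : Fin (d + 1) → ℤ} {m : ℕ} (hm : 0 < m) (n : ℕ) :
    ∀ a b : Fin (d + 1) → ℤ, (∀ i, lo i ≤ a i) → (∀ i, b i ≤ hi i) → (∀ i, a i + m ≤ b i) →
      (∑ i, ((hi i - b i) + (a i - lo i))) = n →
      SlicesGood C lo hi a b m → Good C (Box a b) → Good C (Box lo hi) := by
  induction n with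
  | zero =>
    intro a b h1 h2 h3 hn _ hG
    have h0 := (Finset.sum_eq_zero_iff_of_nonneg fun i _ => by
      have := h1 i; have := h2 i; omega).mp hn
    have : a = lo := by
      ext i
      have := h0 i (by simp); have := h1 i; have := h2 i
      omega
    have : b = hi := by
      ext i
      have := h0 i (by simp); have := h1 i; have := h2 i
      omega
    subst a b
    exact hG
  | succ n ih =>
    intro a b h1 h2 h3 hn hS hG
    have hab : ∀ i, a i < b i := fun i => by have := h3 i; omega
    have hface : ∀ i t, lo i ≤ t → t ≤ hi i → (t < a i ∨ b i < t) →
        Good (slice C i t) (Box (i.removeNth a) (i.removeNth b)) := fun i t ht1 ht2 ht3 =>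
      -- Every side of the face is at least `m`, so goodness of cubes of the single size `m`
      -- suffices at all stages of the growth.
      good_box_of_cubes hm (fun j => h3 _) fun c hc1 hc2 =>
        hS i t ht1 ht2 ht3 c (fun j => (h1 _).trans (hc1 j)) fun j => (hc2 j).trans (h2 _)
    by_cases hb : ∃ i, b i < hi i
    · obtain ⟨i, hi'⟩ := hb
      have hup : ∀ j, b j ≤ Function.update b i (b i + 1) j := fun j => by
        rcases eq_or_ne j i with rfl | hj <;> simp [*]
      refine ih a (Function.update b i (b i + 1)) h1 (fun j => ?_) (fun j => (h3 j).trans (hup j))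
        ?_ (fun j t ht1 ht2 ht3 => hS j t ht1 ht2 (ht3.imp_right (hup j).trans_lt))
        (hG.box_add_top hab i (hface i _ (by have := h1 i; have := hab i; omega) (by omega)
          (Or.inr (by omega))))
      · rcases eq_or_ne j i with rfl | hj
        · simpa using hi'
        · simpa [hj] using h2 j
      · rw [← Finset.add_sum_erase _ _ (Finset.mem_univ i)] at hn ⊢
        have : ∑ x ∈ Finset.univ.erase i,
            (hi x - Function.update b i (b i + 1) x + (a x - lo x)) =
            ∑ x ∈ Finset.univ.erase i, (hi x - b x + (a x - lo x)) :=
          Finset.sum_congr rfl fun x hx => by rw [Function.update_of_ne (Finset.ne_of_mem_erase hx)]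
        rw [this, Function.update_self]
        push_cast at hn
        linarith
    · push Not at hb
      obtain ⟨i, hi'⟩ : ∃ i, lo i < a i := by
        by_contra! hcon
        have : ∑ i, ((hi i - b i) + (a i - lo i)) ≤ 0 := Finset.sum_nonpos fun i _ => by
          have := hb i; have := hcon i; omega
        push_cast at hn
        omega
      have hdn : ∀ j, Function.update a i (a i - 1) j ≤ a j := fun j => by
        rcases eq_or_ne j i with rfl | hj <;> simp [*]
      refine ih (Function.update a i (a i - 1)) b (fun j => ?_) h2
        (fun j => (add_le_add_left (hdn j) _).trans (h3 j))
        ?_ (fun j t ht1 ht2 ht3 => hS j t ht1 ht2 (ht3.imp_left fun h => h.trans_le (hdn j)))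
        (hG.box_add_bottom hab i (hface i _ (by omega)
          (by have := h2 i; have := hab i; omega) (Or.inl (by omega))))
      · rcases eq_or_ne j i with rfl | hj
        · simp; omega
        · simpa [hj] using h1 j
      · rw [← Finset.add_sum_erase _ _ (Finset.mem_univ i)] at hn ⊢
        have : ∑ x ∈ Finset.univ.erase i,
            (hi x - b x + (Function.update a i (a i - 1) x - lo x)) =
            ∑ x ∈ Finset.univ.erase i, (hi x - b x + (a x - lo x)) :=
          Finset.sum_congr rfl fun x hx => by rw [Function.update_of_ne (Finset.ne_of_mem_erase hx)]
        rw [this, Function.update_self]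
        push_cast at hn
        linarith

lemma SlicesGood.good {lo hi a b : Fin (d + 1) → ℤ} {m : ℕ} (hm : 0 < m)
    (h1 : ∀ i, lo i ≤ a i) (h2 : ∀ i, b i ≤ hi i) (h3 : ∀ i, a i + m ≤ b i)
    (hS : SlicesGood C lo hi a b m) (hG : Good C (Box a b)) : Good C (Box lo hi) :=
  Good.grow hm _ a b h1 h2 h3
    (Int.toNat_of_nonneg (Finset.sum_nonneg fun i _ => by
      have := h1 i; have := h2 i; omega)).symm hS hG

end Growth

/-! ### Independence of events with disjoint finite supports -/

section Independence

variable {Ω ι κ : Type*} [MeasurableSpace Ω] {μ : Measure Ω} {c : ι → Ω → Bool}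

lemma measurableSet_of_dependsOn (hc : ∀ i, Measurable (c i)) {F : (ι → Bool) → Prop}
    {S : Finset ι} (hF : DependsOn F (S : Set ι)) : MeasurableSet {ω | F fun i => c i ω} := by
  classical
  have : {ω | F fun i => c i ω} = (fun ω (i : S) => c i ω) ⁻¹'
      {z | F fun i => if h : i ∈ S then z ⟨i, h⟩ else false} := by
    ext ω
    exact (hF fun i hi => by simp [Finset.mem_coe.mp hi]).to_iff
  rw [this]
  have hm : Measurable fun ω (i : S) => c i ω := measurable_pi_lambda _ fun i => hc i
  exact hm (Set.toFinite _).measurableSet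

lemma measure_and_of_dependsOn [IsProbabilityMeasure μ] (hc : ∀ i, Measurable (c i))
    (hi : iIndepFun c μ) {F G : (ι → Bool) → Prop} {S T : Finset ι} (hST : Disjoint S T)
    (hF : DependsOn F (S : Set ι)) (hG : DependsOn G (T : Set ι)) :
    μ.real {ω | F (fun i => c i ω) ∧ G fun i => c i ω} =
      μ.real {ω | F fun i => c i ω} * μ.real {ω | G fun i => c i ω} := by
  classical
  have hind := hi.indepFun_finset S T hST hc
  have h := hind.measure_inter_preimage_eq_mul
    {z | F fun i => if h : i ∈ S then z ⟨i, h⟩ else false}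
    {z | G fun i => if h : i ∈ T then z ⟨i, h⟩ else false}
    (Set.toFinite _).measurableSet (Set.toFinite _).measurableSet
  have hF' : {ω | F fun i => c i ω} = (fun ω (i : S) => c i ω) ⁻¹'
      {z | F fun i => if h : i ∈ S then z ⟨i, h⟩ else false} := by
    ext ω
    exact (hF fun i hi => by simp [Finset.mem_coe.mp hi]).to_iff
  have hG' : {ω | G fun i => c i ω} = (fun ω (i : T) => c i ω) ⁻¹'
      {z | G fun i => if h : i ∈ T then z ⟨i, h⟩ else false} := by
    ext ω
    exact (hG fun i hi => by simp [Finset.mem_coe.mp hi]).to_iff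
  rw [← hF', ← hG'] at h
  have := congrArg ENNReal.toReal h
  rwa [ENNReal.toReal_mul] at this

/-- Events that depend on disjoint finite sets of independent variables are independent. -/
lemma measure_forall_of_dependsOn [IsProbabilityMeasure μ] (hc : ∀ i, Measurable (c i))
    (hi : iIndepFun c μ) (T : Finset κ) {F : κ → (ι → Bool) → Prop} {S : κ → Finset ι}
    (hS : (T : Set κ).PairwiseDisjoint S) (hF : ∀ t ∈ T, DependsOn (F t) (S t : Set ι)) :
    μ.real {ω | ∀ t ∈ T, F t fun i => c i ω} = ∏ t ∈ T, μ.real {ω | F t fun i => c i ω} := by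
  classical
  induction T using Finset.induction_on with
  | empty => simp
  | insert a T ha ih =>
    rw [Finset.prod_insert ha, ← ih (hS.subset (by simp)) fun t ht => hF t (by simp [ht]),
      ← measure_and_of_dependsOn hc hi (S := S a) (T := T.biUnion S)
        (G := fun z => ∀ t ∈ T, F t z) ?_ (hF a (by simp)) ?_]
    · simp
    · rw [Finset.disjoint_biUnion_right]
      exact fun t ht => hS (by simp) (by simp [ht]) (by rintro rfl; exact ha ht)
    · intro z z' h
      refine propext (forall₂_congr fun t ht => (hF t (by simp [ht]) fun i hi => h i ?_).to_iff)
      simp only [Finset.coe_biUnion, Set.mem_iUnion]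
      exact ⟨t, ht, hi⟩

end Independence

/-- Independent closed sites, each closed with probability at least `p`. -/
structure IndepClosed {Ω ι : Type*} [MeasurableSpace Ω] (μ : Measure Ω) (p : ℝ)
    (c : ι → Ω → Bool) : Prop where
  meas : ∀ i, Measurable (c i)
  indep : iIndepFun c μ
  le_prob : ∀ i, p ≤ μ.real {ω | c i ω = true}

lemma IndepClosed.comp {Ω ι κ : Type*} [MeasurableSpace Ω] {μ : Measure Ω} {p : ℝ}
    {c : ι → Ω → Bool} (h : IndepClosed μ p c) {f : κ → ι} (hf : Function.Injective f) :
    IndepClosed μ p fun k => c (f k) :=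
  ⟨fun _ => h.meas _, h.indep.precomp hf, fun _ => h.le_prob _⟩

lemma IndepClosed.pow_le {Ω ι : Type*} [MeasurableSpace Ω] {μ : Measure Ω}
    [IsProbabilityMeasure μ] {p : ℝ} (hp : 0 ≤ p) {c : ι → Ω → Bool} (h : IndepClosed μ p c)
    (S : Finset ι) : p ^ S.card ≤ μ.real {ω | ∀ i ∈ S, c i ω = true} := by
  classical
  rw [measure_forall_of_dependsOn (c := c) h.meas h.indep S (F := fun i z => z i = true)
    (S := fun i => {i}) (fun i _ j _ hij => by simpa using hij)
    (fun i _ z z' hz => by simp [hz i (by simp)])]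
  rw [← Finset.prod_const]
  exact Finset.prod_le_prod (fun _ _ => hp) fun i _ => h.le_prob i

/-- Cubes of side `n` in dimension `d` fail to be good with probability of smaller order than any
power of `n`. -/
def CubesLikelyGood (d : ℕ) (p : ℝ) : Prop :=
  ∀ k : ℕ, ∃ K : ℝ, 0 ≤ K ∧ ∀ (Ω : Type) (_ : MeasurableSpace Ω) (μ : Measure Ω)
    (_ : IsProbabilityMeasure μ) (c : (Fin d → ℤ) → Ω → Bool), IndepClosed μ p c →
    ∀ (a : Fin d → ℤ) (n : ℕ),
      μ.real {ω | ¬ Good (fun y => c y ω) (Cube a n)} ≤ K / (n + 1) ^ k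

/-- In dimension zero there are one even and one odd vertex, and they match each other. -/
lemma cubesLikelyGood_zero (p : ℝ) : CubesLikelyGood 0 p := by
  refine fun k => ⟨0, le_rfl, fun Ω _ μ _ c _ a n => ?_⟩
  have : ∀ ω, Good (fun y => c y ω) (Cube a n) := fun ω =>
    ⟨id, fun y _ _ => ⟨fun i => i.elim0, fun i => i.elim0⟩, fun _ _ _ _ h => h⟩
  simp [this]

section Dependence

variable {d : ℕ}

lemma dependsOn_good (A : Set (Fin d → ℤ)) : DependsOn (fun C => Good C A) (nbhd A) :=
  fun _ _ h => propext (good_congr h)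

lemma dependsOn_good_cube (a : Fin d → ℤ) (n : ℕ) :
    DependsOn (fun C => Good C (Cube a n)) (Finset.Icc a (fun i => a i + n) : Set (Fin d → ℤ)) :=
  (dependsOn_good _).mono (by rw [Finset.coe_Icc]; exact nbhd_box_subset _ _)

/-- Only layers missing `Icc a b` are inspected; this makes the growth conditions independent of the
seed inside. -/
lemma dependsOn_slicesGood (lo hi a b : Fin (d + 1) → ℤ) (m : ℕ) :
    DependsOn (fun C => SlicesGood C lo hi a b m) (Set.Icc lo hi \ Set.Icc a b) := by
  intro C C' h
  refine propext (forall_congr' fun i => forall_congr' fun t => forall_congr' fun h1 =>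
    forall_congr' fun h2 => forall_congr' fun h3 => forall_congr' fun c => forall_congr' fun h4 =>
    forall_congr' fun h5 => good_congr fun y hy => h _ ⟨?_, fun hab => ?_⟩)
  · have hy := nbhd_box_subset _ _ hy
    rw [Set.mem_Icc, Pi.le_def, Pi.le_def] at hy ⊢
    rw [Fin.forall_iff_succAbove i, Fin.forall_iff_succAbove i]
    simp only [Fin.insertNth_apply_same, Fin.insertNth_apply_succAbove]
    exact ⟨⟨h1, fun j => (h4 j).trans (hy.1 j)⟩, ⟨h2, fun j => (hy.2 j).trans (h5 j)⟩⟩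
  · have h6 := hab.1 i
    have h7 := hab.2 i
    simp only [Fin.insertNth_apply_same] at h6 h7
    omega

lemma card_Icc_cube (x : Fin d → ℤ) (n : ℕ) :
    (Finset.Icc x (fun i => x i + n)).card = (n + 1) ^ d := by
  have : ∀ i, (x i + n + 1 - x i).toNat = n + 1 := fun i => by omega
  simp [Pi.card_Icc, this]

end Dependence

/-! ### Seeds and the induction on the dimension -/

section Seeds

variable {d : ℕ} {p : ℝ} {Ω : Type} [MeasurableSpace Ω] {μ : Measure Ω} [IsProbabilityMeasure μ]
  {c : (Fin (d + 1) → ℤ) → Ω → Bool}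

lemma measure_not_slicesGood_le {m N : ℕ} (hmN : m ≤ N) {ε : ℝ}
    (hε : ∀ (i : Fin (d + 1)) t (a : Fin d → ℤ),
      μ.real {ω | ¬ Good (slice (fun y => c y ω) i t) (Cube a m)} ≤ ε)
    (x a b : Fin (d + 1) → ℤ) :
    μ.real {ω | ¬ SlicesGood (fun y => c y ω) x (fun i => x i + N) a b m} ≤
      (d + 1) * ((N + 1) * ((N - m + 1 : ℕ) ^ d * ε)) := by
  have hsub : {ω | ¬ SlicesGood (fun y => c y ω) x (fun i => x i + N) a b m} ⊆
      ⋃ i ∈ (Finset.univ : Finset (Fin (d + 1))), ⋃ t ∈ Finset.Icc (x i) (x i + N),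
        ⋃ e ∈ Finset.Icc (fun j => x (i.succAbove j))
          (fun j => x (i.succAbove j) + (N - m : ℕ)),
          {ω | ¬ Good (slice (fun y => c y ω) i t) (Cube e m)} := by
    intro ω hω
    simp only [SlicesGood, Set.mem_ofPred_eq, not_forall] at hω
    obtain ⟨i, t, h1, h2, h3, e, h4, h5, h6⟩ := hω
    simp only [Set.mem_iUnion, exists_prop, Finset.mem_Icc, Finset.mem_univ, true_and]
    refine ⟨i, t, ⟨h1, h2⟩, e, ⟨h4, fun j => ?_⟩, h6⟩
    have := h5 j
    simp only [Fin.removeNth] at this ⊢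
    omega
  refine (measureReal_mono hsub (measure_ne_top _ _)).trans ((measureReal_biUnion_finset_le _ _).trans ?_)
  have h1 : ∀ i t, μ.real (⋃ e ∈ Finset.Icc (fun j => x (i.succAbove j))
      (fun j => x (i.succAbove j) + (N - m : ℕ)),
      {ω | ¬ Good (slice (fun y => c y ω) i t) (Cube e m)}) ≤ (N - m + 1 : ℕ) ^ d * ε := by
    intro i t
    refine (measureReal_biUnion_finset_le _ _).trans
      ((Finset.sum_le_card_nsmul _ _ ε fun e _ => hε i t e).trans_eq ?_)
    rw [card_Icc_cube, nsmul_eq_mul]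
    push_cast
    rfl
  refine (Finset.sum_le_card_nsmul _ _ ((N + 1) * ((N - m + 1 : ℕ) ^ d * ε)) fun i _ => ?_).trans_eq
    (by simp)
  refine (measureReal_biUnion_finset_le _ _).trans
    ((Finset.sum_le_card_nsmul _ _ _ fun t _ => h1 i t).trans_eq ?_)
  have : (x i + N + 1 - x i).toNat = N + 1 := by omega
  simp [this]

lemma sum_inv_sq_le {m₀ m : ℕ} (h0 : 0 < m₀) (h : m₀ ≤ m) :
    ∑ k ∈ Finset.Ico m₀ m, 1 / ((k : ℝ) + 1) ^ 2 ≤ 1 / (m₀ : ℝ) - 1 / m := by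
  induction m, h using Nat.le_induction with
  | base => simp
  | succ m hm ih =>
    rw [Finset.sum_Ico_succ_top hm]
    have hm0 : (0 : ℝ) < m := by exact_mod_cast h0.trans_le hm
    have : 1 / ((m : ℝ) + 1) ^ 2 ≤ 1 / m - 1 / (m + 1) := by
      rw [div_sub_div _ _ hm0.ne' (by positivity), div_le_div_iff₀ (by positivity) (by positivity)]
      nlinarith
    push_cast
    linarith

lemma good_cube_of_seed {C : (Fin (d + 1) → ℤ) → Bool} {x : Fin (d + 1) → ℤ} {m₀ m : ℕ}
    (h0 : 0 < m₀) (hm : m₀ ≤ m) (hseed : ∀ y ∈ Finset.Icc x (fun i => x i + m₀), C y = true)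
    (hS : ∀ k ∈ Finset.Ico m₀ m,
      SlicesGood C x (fun i => x i + (k + 1 : ℕ)) x (fun i => x i + k) k) :
    Good C (Cube x m) := by
  induction m, hm using Nat.le_induction with
  | base =>
    refine good_of_closed fun y hy => hseed y ?_
    rw [Finset.mem_Icc]
    exact nbhd_box_subset _ _ hy
  | succ m hm ih =>
    refine (hS m (by simp [hm])).good (h0.trans_le hm) (fun _ => le_rfl)
      (fun i => by push_cast; omega) (fun _ => le_rfl) (ih fun k hk => hS k ?_)
    simp only [Finset.mem_Ico] at hk ⊢
    omega

/-- Large cubes are good with probability bounded away from zero. -/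
lemma CubesLikelyGood.exists_seed_prob (h : CubesLikelyGood d p) (hp : 0 < p) :
    ∃ m₀ : ℕ, 0 < m₀ ∧ ∃ ρ : ℝ, 0 < ρ ∧ ρ ≤ 1 ∧ ∀ (Ω : Type) (_ : MeasurableSpace Ω)
      (μ : Measure Ω) (_ : IsProbabilityMeasure μ) (c : (Fin (d + 1) → ℤ) → Ω → Bool),
      IndepClosed μ p c → ∀ x m, m₀ ≤ m → ρ ≤ μ.real {ω | Good (fun y => c y ω) (Cube x m)} := by
  -- Growing from side `k` to `k + 1` inspects of order `k` cubes of lower dimension. The third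
  -- power leaves a bound `B / (k + 1) ^ 2`, whose tail from `m₀` is at most `B / m₀ < 1 / 2`.
  obtain ⟨K, hK, hgood⟩ := h 3
  set B : ℝ := (d + 1) * (2 * (2 ^ d * K)) with hB
  have hB0 : 0 ≤ B := by positivity
  obtain ⟨m₀, hm₀⟩ := exists_nat_gt (2 * B)
  have h0 : 0 < m₀ := by
    have : (0 : ℝ) < m₀ := by linarith
    exact_mod_cast this
  refine ⟨m₀, h0, min 1 (p ^ ((m₀ + 1) ^ (d + 1)) * (1 / 2)), by positivity, min_le_left _ _, ?_⟩
  intro Ω _ μ hμ c hc x m hm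
  refine (min_le_right _ _).trans ?_
  have hslice : ∀ k (i : Fin (d + 1)) t (a : Fin d → ℤ),
      μ.real {ω | ¬ Good (slice (fun y => c y ω) i t) (Cube a k)} ≤ K / (k + 1) ^ 3 :=
    fun k i t a => hgood Ω _ μ hμ _
      (hc.comp (Fin.insertNth_right_injective (α := fun _ => ℤ) (p := i) t)) a k
  set E : ((Fin (d + 1) → ℤ) → Bool) → Prop := fun C => ∀ k ∈ Finset.Ico m₀ m,
      SlicesGood C x (fun i => x i + (k + 1 : ℕ)) x (fun i => x i + k) k with hE
  have hEdep : DependsOn E ((Finset.Icc x (fun i => x i + m) \ Finset.Icc x (fun i => x i + m₀) :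
      Finset (Fin (d + 1) → ℤ)) : Set (Fin (d + 1) → ℤ)) := by
    intro C C' hCC
    refine propext (forall₂_congr fun k hk => (dependsOn_slicesGood _ _ _ _ _ ?_).to_iff)
    rintro y ⟨hy1, hy2⟩
    refine hCC y ?_
    rw [Finset.mem_Ico] at hk
    rw [Finset.coe_sdiff, Finset.coe_Icc, Finset.coe_Icc]
    refine ⟨⟨hy1.1, hy1.2.trans fun i => ?_⟩, fun hy => hy2 ⟨hy.1, hy.2.trans fun i => ?_⟩⟩ <;>
      dsimp only <;> omega
  have hEc : μ.real {ω | ¬ E fun y => c y ω} ≤ 1 / 2 := by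
    have hsub : {ω | ¬ E fun y => c y ω} ⊆ ⋃ k ∈ Finset.Ico m₀ m,
        {ω | ¬ SlicesGood (fun y => c y ω) x (fun i => x i + (k + 1 : ℕ)) x
          (fun i => x i + k) k} := by
      intro ω hω
      simp only [hE, Set.mem_ofPred_eq, not_forall] at hω
      simpa using hω
    refine (measureReal_mono hsub (measure_ne_top _ _)).trans ((measureReal_biUnion_finset_le _ _).trans ?_)
    have hk : ∀ k ∈ Finset.Ico m₀ m, μ.real {ω | ¬ SlicesGood (fun y => c y ω) x
        (fun i => x i + (k + 1 : ℕ)) x (fun i => x i + k) k} ≤ B * (1 / ((k : ℝ) + 1) ^ 2) := by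
      intro k _
      refine (measure_not_slicesGood_le (Nat.le_succ k) (hslice k) x _ _).trans ?_
      have h2 : k + 1 - k + 1 = 2 := by omega
      rw [h2, hB]
      push_cast
      have hk0 : (0 : ℝ) ≤ k := k.cast_nonneg
      rw [mul_assoc]
      refine mul_le_mul_of_nonneg_left ?_ (by positivity)
      have : (2 * (2 ^ d * K)) * (1 / ((k : ℝ) + 1) ^ 2) =
          (2 * (k + 1)) * (2 ^ d * (K / (k + 1) ^ 3)) := by
        field_simp
      rw [this]
      refine mul_le_mul_of_nonneg_right (by linarith) (by positivity)
    refine (Finset.sum_le_sum hk).trans ?_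
    rw [← Finset.mul_sum]
    have hm₀' : (0 : ℝ) < m₀ := by exact_mod_cast h0
    have := sum_inv_sq_le h0 hm
    have h3 : (0 : ℝ) ≤ 1 / m := by positivity
    calc B * ∑ k ∈ Finset.Ico m₀ m, 1 / ((k : ℝ) + 1) ^ 2 ≤ B * (1 / m₀) :=
          mul_le_mul_of_nonneg_left (by linarith) hB0
      _ ≤ 1 / 2 := by
          rw [mul_one_div, div_le_div_iff₀ hm₀' (by norm_num)]
          linarith
  have hE' : 1 / 2 ≤ μ.real {ω | E fun y => c y ω} := by
    have hme := measurableSet_of_dependsOn hc.meas hEdep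
    have := probReal_compl_eq_one_sub (μ := μ) hme
    rw [Set.compl_ofPred] at this
    linarith
  have hind := measure_and_of_dependsOn hc.meas hc.indep
    (F := fun C => ∀ y ∈ Finset.Icc x (fun i => x i + m₀), C y = true) (G := E)
    Finset.disjoint_sdiff (fun C C' hCC => propext (forall₂_congr fun y hy => by rw [hCC y hy]))
    hEdep
  have hpow := hc.pow_le hp.le (Finset.Icc x (fun i => x i + m₀))
  rw [card_Icc_cube] at hpow
  calc p ^ ((m₀ + 1) ^ (d + 1)) * (1 / 2) ≤ _ * μ.real {ω | E fun y => c y ω} :=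
        mul_le_mul hpow hE' (by norm_num) measureReal_nonneg
    _ = _ := hind.symm
    _ ≤ _ := measureReal_mono fun ω hω => good_cube_of_seed h0 hm hω.1 hω.2

/-- The cubes are spaced by `m + 1` along the diagonal because a cube of side `m` depends on `m + 1`
odd layers; this makes their goodness independent. -/
lemma measure_no_good_seed_le (hc : IndepClosed μ p c) {ρ : ℝ} {m : ℕ}
    (hρ : ∀ x, ρ ≤ μ.real {ω | Good (fun y => c y ω) (Cube x m)}) (x : Fin (d + 1) → ℤ) (J : ℕ) :
    μ.real {ω | ∀ j ∈ Finset.range J,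
      ¬ Good (fun y => c y ω) (Cube (fun i => x i + (j * (m + 1) : ℕ)) m)} ≤ (1 - ρ) ^ J := by
  have hdep : ∀ j : ℕ, DependsOn (fun C => Good C (Cube (fun i => x i + (j * (m + 1) : ℕ)) m))
      (Finset.Icc (fun i => x i + (j * (m + 1) : ℕ)) (fun i => x i + (j * (m + 1) : ℕ) + m) :
        Finset (Fin (d + 1) → ℤ)) := fun j => dependsOn_good_cube _ _
  rw [measure_forall_of_dependsOn hc.meas hc.indep (Finset.range J)
    (F := fun j C => ¬ Good C (Cube (fun i => x i + (j * (m + 1) : ℕ)) m))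
    (S := fun j => Finset.Icc (fun i => x i + (j * (m + 1) : ℕ))
      (fun i => x i + (j * (m + 1) : ℕ) + m)) ?_ (fun j _ C C' h => by
        simp only [hdep j h])]
  · refine (Finset.prod_le_prod (fun _ _ => measureReal_nonneg) fun j _ => ?_).trans_eq
      (by rw [Finset.prod_const, Finset.card_range])
    have := probReal_compl_eq_one_sub (μ := μ) (measurableSet_of_dependsOn hc.meas (hdep j))
    rw [Set.compl_ofPred] at this
    rw [this]
    linarith [hρ (fun i => x i + (j * (m + 1) : ℕ))]
  · intro j _ k _ hjk
    rw [Function.onFun, Finset.disjoint_left]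
    intro y hy hy'
    rw [Finset.mem_Icc] at hy hy'
    have h1 := hy.1 0
    have h2 := hy.2 0
    have h3 := hy'.1 0
    have h4 := hy'.2 0
    dsimp only at h1 h2 h3 h4
    have h5 : j * (m + 1) ≤ k * (m + 1) + m := by omega
    have h6 : k * (m + 1) ≤ j * (m + 1) + m := by omega
    refine hjk (le_antisymm ?_ ?_) <;> by_contra! hlt
    · have := Nat.mul_le_mul_right (m + 1) hlt
      rw [Nat.succ_mul] at this
      omega
    · have := Nat.mul_le_mul_right (m + 1) hlt
      rw [Nat.succ_mul] at this
      omega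

end Seeds

lemma exists_pow_mul_pow_le (k : ℕ) {r : ℝ} (h0 : 0 ≤ r) (h1 : r < 1) :
    ∃ D : ℝ, 0 ≤ D ∧ ∀ n : ℕ, r ^ n ≤ D / ((n : ℝ) + 1) ^ k := by
  have h := tendsto_pow_const_mul_const_pow_of_lt_one k h0 h1
  obtain ⟨D, hD⟩ := h.bddAbove_range
  have hD' : ∀ n : ℕ, (n : ℝ) ^ k * r ^ n ≤ D := fun n => hD ⟨n, rfl⟩
  refine ⟨2 ^ k * D + 1, ?_, fun n => ?_⟩
  · have := (hD' 0)
    have h2 : 0 ≤ ((0 : ℕ) : ℝ) ^ k * r ^ 0 := by positivity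
    have : 0 ≤ D := h2.trans this
    positivity
  rw [le_div_iff₀ (by positivity)]
  rcases Nat.eq_zero_or_pos n with rfl | hn
  · have h2 : 0 ≤ ((0 : ℕ) : ℝ) ^ k * r ^ 0 := by positivity
    have : 0 ≤ D := h2.trans (hD' 0)
    have : 0 ≤ 2 ^ k * D := by positivity
    simpa using this
  · have hn' : (1 : ℝ) ≤ n := by exact_mod_cast hn
    calc r ^ n * ((n : ℝ) + 1) ^ k ≤ r ^ n * (2 * n) ^ k := by
          gcongr
          linarith
      _ = 2 ^ k * ((n : ℝ) ^ k * r ^ n) := by rw [mul_pow]; ring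
      _ ≤ 2 ^ k * D := by gcongr; exact hD' n
      _ ≤ _ := by linarith

/-- A cube of side `N` contains about `√N` disjoint diagonal cubes of side about `√N`. All of them
fail with probability exponentially small in `√N`; one good cube fills the whole when all layers are
good. -/
lemma CubesLikelyGood.succ {d : ℕ} {p : ℝ} (h : CubesLikelyGood d p) (hp : 0 < p) :
    CubesLikelyGood (d + 1) p := by
  intro k
  obtain ⟨m₀, h0, ρ, hρ0, hρ1, hseed⟩ := h.exists_seed_prob hp
  -- As `N + 1 ≤ 4 * (m + 1) ^ 2`, the `(N + 1) ^ (d + 1)` bounding the number of layer cubes per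
  -- direction and the desired factor `(N + 1) ^ k` together cost this power of `m + 1`.
  obtain ⟨K, hK, hgood⟩ := h (2 * (d + 1 + k))
  obtain ⟨D, hD0, hD⟩ := exists_pow_mul_pow_le (2 * k) (sub_nonneg.mpr hρ1) (by linarith : 1 - ρ < 1)
  refine ⟨((m₀ : ℝ) + 2) ^ (2 * k) + (4 ^ k * D + (d + 1) * (4 ^ (d + 1 + k) * K)), by positivity,
    ?_⟩
  intro Ω _ μ hμ c hc x N
  rw [le_div_iff₀ (by positivity)]
  set s := Nat.sqrt N with hs
  have hs1 : s * s ≤ N := Nat.sqrt_le N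
  have hs2 : N < (s + 1) * (s + 1) := Nat.lt_succ_sqrt N
  by_cases hsm : s < m₀ + 1
  · have hN : ((N : ℝ) + 1) ≤ (m₀ + 2) ^ 2 := by
      have : N + 1 ≤ (m₀ + 2) ^ 2 := by nlinarith
      exact_mod_cast this
    calc _ ≤ 1 * ((m₀ + 2 : ℝ) ^ 2) ^ k :=
          mul_le_mul measureReal_le_one (pow_le_pow_left₀ (by positivity) hN _) (by positivity)
            zero_le_one
      _ = (m₀ + 2 : ℝ) ^ (2 * k) := by rw [one_mul, ← pow_mul]
      _ ≤ _ := le_add_of_nonneg_right (by positivity)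
  · push Not at hsm
    obtain ⟨m, hm⟩ : ∃ m, s = m + 1 := ⟨s - 1, by omega⟩
    rw [hm] at hs1 hs2 hsm
    have hmN : m ≤ N := by nlinarith
    have hm0 : m₀ ≤ m := by omega
    have hu : ((N : ℝ) + 1) ≤ 4 * (m + 1) ^ 2 := by
      have : N + 1 ≤ 4 * (m + 1) ^ 2 := by nlinarith
      exact_mod_cast this
    have hslice : ∀ (i : Fin (d + 1)) t (a : Fin d → ℤ),
        μ.real {ω | ¬ Good (slice (fun y => c y ω) i t) (Cube a m)} ≤
          K / (m + 1) ^ (2 * (d + 1 + k)) := fun i t a => hgood Ω _ μ hμ _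
        (hc.comp (Fin.insertNth_right_injective (α := fun _ => ℤ) (p := i) t)) a m
    have hS : ∀ a b, μ.real {ω | ¬ SlicesGood (fun y => c y ω) x (fun i => x i + N) a b m} ≤
        (d + 1) * ((4 * (m + 1) ^ 2) ^ (d + 1) * (K / (m + 1) ^ (2 * (d + 1 + k)))) := by
      intro a b
      refine (measure_not_slicesGood_le hmN hslice x a b).trans ?_
      rw [pow_succ', mul_assoc]
      have : ((N - m + 1 : ℕ) : ℝ) ≤ 4 * (m + 1) ^ 2 := by
        refine le_trans ?_ hu
        have : N - m + 1 ≤ N + 1 := by omega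
        exact_mod_cast this
      gcongr
    have hsub : {ω | ¬ Good (fun y => c y ω) (Cube x N)} ⊆
        {ω | ∀ j ∈ Finset.range m,
          ¬ Good (fun y => c y ω) (Cube (fun i => x i + (j * (m + 1) : ℕ)) m)} ∪
        -- The lower corner `x + N + 1` lies beyond the cube, so no layer is exempt and the
        -- condition does not depend on which diagonal cube is good.
        {ω | ¬ SlicesGood (fun y => c y ω) x (fun i => x i + N) (fun i => x i + N + 1) x m} := by
      intro ω hω
      by_contra hcon
      simp only [Set.mem_union, Set.mem_ofPred_eq, not_or, not_forall, not_not, exists_prop] at hcon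
      obtain ⟨⟨j, hj, hG⟩, hSG⟩ := hcon
      refine hω ?_
      rw [Finset.mem_range] at hj
      have hjm : j * (m + 1) + m ≤ N := by
        have := Nat.mul_le_mul_right (m + 1) hj
        nlinarith
      refine SlicesGood.good (lt_of_lt_of_le h0 hm0) (fun i => ?_) (fun i => ?_) (fun i => le_rfl)
        (fun i t h1 h2 _ => hSG i t h1 h2 (Or.inl (Int.lt_add_one_of_le h2))) hG
      all_goals omega
    have h1 := (measureReal_mono (μ := μ) hsub (measure_ne_top _ _)).trans (measureReal_union_le _ _)
    have h2 := measure_no_good_seed_le hc (fun x => hseed Ω _ μ hμ c hc x m hm0) x m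
    have h3 := h2.trans (hD m)
    have hm1 : (0 : ℝ) < (m : ℝ) + 1 := by positivity
    calc _ ≤ (D / ((m : ℝ) + 1) ^ (2 * k) +
          (d + 1) * ((4 * (m + 1) ^ 2) ^ (d + 1) * (K / (m + 1) ^ (2 * (d + 1 + k))))) *
          (4 * (m + 1) ^ 2) ^ k := by
          gcongr
          exact h1.trans (add_le_add h3 (hS _ _))
      _ = 4 ^ k * D + (d + 1) * (4 ^ (d + 1 + k) * K) := by
          rw [mul_pow, mul_pow, ← pow_mul, ← pow_mul]
          field_simp
          ring
      _ ≤ _ := le_add_of_nonneg_left (by positivity)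

theorem cubesLikelyGood (d : ℕ) {p : ℝ} (hp : 0 < p) : CubesLikelyGood d p := by
  induction d with
  | zero => exact cubesLikelyGood_zero p
  | succ d ih => exact ih.succ hp

/-! ### Finiteness of clusters by path counting -/

section Cluster

variable {d : ℕ}

/-- Two points differ by at most one in every coordinate. -/
def Near (b b' : Fin d → ℤ) : Prop := ∀ i, |b i - b' i| ≤ 1

/-- The set of points that can be reached from `b₀` by steps between near points that lead to
points with the property `R`. -/
def cluster (R : (Fin d → ℤ) → Prop) (b₀ : Fin d → ℤ) : Set (Fin d → ℤ) :=
  {b | Relation.ReflTransGen (fun u v => Near u v ∧ R v) b₀ b}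

/-- The graph whose paths from `b₀` explore the cluster of `b₀`. -/
def clusterGraph (R : (Fin d → ℤ) → Prop) (b₀ : Fin d → ℤ) : SimpleGraph (Fin d → ℤ) where
  Adj u v := u ≠ v ∧ Near u v ∧ (u = b₀ ∨ R u) ∧ (v = b₀ ∨ R v)
  symm := ⟨fun _ _ h =>
    ⟨h.1.symm, fun i => by rw [abs_sub_comm]; exact h.2.1 i, h.2.2.2, h.2.2.1⟩⟩
  loopless := ⟨fun _ h => h.1 rfl⟩

lemma reachable_of_mem_cluster {R : (Fin d → ℤ) → Prop} {b₀ b : Fin d → ℤ}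
    (h : b ∈ cluster R b₀) : (clusterGraph R b₀).Reachable b₀ b ∧ (b = b₀ ∨ R b) := by
  induction h with
  | refl => exact ⟨SimpleGraph.Reachable.refl _, Or.inl rfl⟩
  | @tail u v _ huv ih =>
    refine ⟨?_, Or.inr huv.2⟩
    by_cases hne : u = v
    · exact hne ▸ ih.1
    · exact ih.1.trans (SimpleGraph.Adj.reachable ⟨hne, huv.1, ih.2, Or.inr huv.2⟩)

lemma abs_sub_le_length {R : (Fin d → ℤ) → Prop} {b₀ u v : Fin d → ℤ}
    (w : (clusterGraph R b₀).Walk u v) (i : Fin d) : |u i - v i| ≤ w.length := by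
  induction w with
  | nil => simp
  | @cons u x v h w ih =>
    have := abs_sub_le (u i) (x i) (v i)
    have := h.2.1 i
    rw [SimpleGraph.Walk.length_cons]
    push_cast
    omega

lemma exists_path_of_infinite {R : (Fin d → ℤ) → Prop} {b₀ : Fin d → ℤ}
    (h : (cluster R b₀).Infinite) (L : ℕ) : ∃ γ : ℕ → Fin d → ℤ, γ 0 = b₀ ∧
      Set.InjOn γ (Set.Iic L) ∧ (∀ n < L, Near (γ n) (γ (n + 1))) ∧
      ∀ n, 1 ≤ n → n ≤ L → R (γ n) := by
  obtain ⟨b, hb, i, hi⟩ : ∃ b ∈ cluster R b₀, ∃ i, (L : ℤ) < |b₀ i - b i| := by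
    by_contra! hcon
    refine h ((Set.finite_Icc (fun i => b₀ i - L) (fun i => b₀ i + L)).subset fun b hb => ?_)
    rw [Set.mem_Icc, Pi.le_def, Pi.le_def]
    refine ⟨fun i => ?_, fun i => ?_⟩ <;> have := abs_le.mp (hcon b hb i) <;> omega
  obtain ⟨w, hw⟩ := (reachable_of_mem_cluster hb).1.exists_isPath
  have hL : L < w.length := by exact_mod_cast hi.trans_le (abs_sub_le_length w i)
  have hinj : Set.InjOn w.getVert (Set.Iic L) :=
    hw.getVert_injOn.mono fun n (hn : n ≤ L) => (hn.trans hL.le : n ≤ w.length)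
  refine ⟨w.getVert, w.getVert_zero, hinj, fun n hn => (w.adj_getVert_succ (hn.trans hL)).2.1,
    fun n h1 hn => ?_⟩
  have hadj := w.adj_getVert_succ (i := n - 1) (by omega)
  rw [Nat.sub_add_cancel h1] at hadj
  -- The starting point need not satisfy `R`, but a simple path does not return to it.
  refine hadj.2.2.2.resolve_left fun heq => ?_
  have := hinj (x₁ := n) (x₂ := 0) hn (Nat.zero_le L) (by rw [heq, w.getVert_zero])
  omega

/-- The path from `b₀` with prescribed steps. -/
def pathOfSteps {L : ℕ} (b₀ : Fin d → ℤ) (s : Fin L → Fin d → Fin 3) (n : ℕ) : Fin d → ℤ :=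
  fun i => b₀ i + ∑ j ∈ Finset.range n, if h : j < L then ((s ⟨j, h⟩ i : ℕ) : ℤ) - 1 else 0

lemma exists_steps {L : ℕ} {γ : ℕ → Fin d → ℤ} (h : ∀ n < L, Near (γ n) (γ (n + 1))) :
    ∃ s : Fin L → Fin d → Fin 3, ∀ n ≤ L, pathOfSteps (γ 0) s n = γ n := by
  have hb : ∀ (j : Fin L) i, -1 ≤ γ (j + 1) i - γ j i ∧ γ (j + 1) i - γ j i ≤ 1 := fun j i => by
    have := abs_le.mp (h j j.2 i)
    omega
  refine ⟨fun j i => ⟨(γ (j + 1) i - γ j i + 1).toNat, by have := hb j i; omega⟩, fun n hn => ?_⟩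
  induction n with
  | zero => ext i; simp [pathOfSteps]
  | succ n ih =>
    ext i
    have h1 := congrFun (ih (by omega)) i
    simp only [pathOfSteps] at h1 ⊢
    have h2 := hb ⟨n, hn⟩ i
    rw [Finset.sum_range_succ, dif_pos (show n < L from hn), ← add_assoc, h1]
    dsimp only at h2 ⊢
    omega

lemma exists_large_parity_class {T : Finset (Fin d → ℤ)} {k : ℕ} (hT : 2 ^ d * k ≤ T.card) :
    ∃ U ⊆ T, k ≤ U.card ∧ ∀ b ∈ U, ∀ b' ∈ U, ∀ i, (2 : ℤ) ∣ b i - b' i := by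
  classical
  obtain ⟨r, -, hr⟩ := Finset.exists_le_card_fiber_of_mul_le_card_of_maps_to
    (s := T) (t := (Finset.univ : Finset (Fin d → ZMod 2))) (n := k)
    (f := fun b i => (b i : ZMod 2)) (fun _ _ => Finset.mem_univ _)
    Finset.univ_nonempty (by simpa [ZMod.card] using hT)
  refine ⟨_, Finset.filter_subset _ _, hr, fun b hb b' hb' i => ?_⟩
  have h1 := congrFun (Finset.mem_filter.mp hb).2 i
  have h2 := congrFun (Finset.mem_filter.mp hb').2 i
  have := (ZMod.intCast_eq_intCast_iff_dvd_sub (b' i) (b i) 2).mp (h2.trans h1.symm)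
  exact_mod_cast this

variable {Ω : Type*} [MeasurableSpace Ω] {μ : Measure Ω} [IsProbabilityMeasure μ]

/-- If sites are unlikely to have the property `R`, and are independent when their differences are
even, then clusters are almost surely finite. -/
lemma ae_finite_cluster {R : Ω → (Fin d → ℤ) → Prop} {ε : ℝ} (hε0 : 0 ≤ ε) (hε1 : ε ≤ 1)
    (hε : ((3 ^ d) ^ 2 ^ d : ℕ) * ε < 1)
    (hR : ∀ T : Finset (Fin d → ℤ), (∀ b ∈ T, ∀ b' ∈ T, ∀ i, (2 : ℤ) ∣ b i - b' i) →
      μ.real {ω | ∀ b ∈ T, R ω b} ≤ ε ^ T.card) (b₀ : Fin d → ℤ) :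
    ∀ᵐ ω ∂μ, (cluster (R ω) b₀).Finite := by
  classical
  -- An infinite cluster contains a simple path of length `2 ^ d * k`, for which there are at most
  -- `(3 ^ d) ^ (2 ^ d * k)` step sequences. By pigeonhole `k` of its sites agree modulo two, and
  -- this costs `ε ^ k`.
  have hbound : ∀ k : ℕ, μ.real {ω | (cluster (R ω) b₀).Infinite} ≤
      (((3 ^ d) ^ 2 ^ d : ℕ) * ε) ^ k := by
    intro k
    set L := 2 ^ d * k with hL
    have hsub : {ω | (cluster (R ω) b₀).Infinite} ⊆
        ⋃ s ∈ (Finset.univ : Finset (Fin L → Fin d → Fin 3)),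
          {ω | Set.InjOn (pathOfSteps b₀ s) (Set.Iic L) ∧
            ∀ n, 1 ≤ n → n ≤ L → R ω (pathOfSteps b₀ s n)} := by
      intro ω hω
      obtain ⟨γ, rfl, hinj, hnear, hRγ⟩ := exists_path_of_infinite hω L
      obtain ⟨s, hs⟩ := exists_steps hnear
      simp only [Set.mem_iUnion, Finset.mem_univ, exists_prop, true_and]
      refine ⟨s, hinj.congr fun n hn => (hs n hn).symm, fun n h1 h2 => ?_⟩
      rw [hs n h2]
      exact hRγ n h1 h2
    refine (measureReal_mono hsub (measure_ne_top _ _)).trans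
      ((measureReal_biUnion_finset_le _ _).trans
      ((Finset.sum_le_card_nsmul _ _ (ε ^ k) fun s _ => ?_).trans_eq ?_))
    · by_cases hinj : Set.InjOn (pathOfSteps b₀ s) (Set.Iic L)
      · set T := (Finset.Icc 1 L).image (pathOfSteps b₀ s) with hT
        have hcard : T.card = L := by
          rw [hT, Finset.card_image_of_injOn (hinj.mono fun n hn => by
            simpa using (Finset.mem_Icc.mp hn).2), Nat.card_Icc, Nat.add_sub_cancel]
        obtain ⟨U, hUT, hUk, hU⟩ := exists_large_parity_class (hcard.trans hL).ge
        refine (measureReal_mono (s₂ := {ω | ∀ b ∈ U, R ω b}) ?_ (measure_ne_top _ _)).trans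
          ((hR U hU).trans (pow_le_pow_of_le_one hε0 hε1 hUk))
        rintro ω ⟨-, hω⟩ b hb
        obtain ⟨n, hn, rfl⟩ := Finset.mem_image.mp (hUT hb)
        rw [Finset.mem_Icc] at hn
        exact hω n hn.1 hn.2
      · simp only [hinj, false_and]
        simpa using pow_nonneg hε0 k
    · rw [mul_pow, nsmul_eq_mul]
      simp [hL, pow_mul]
  have h0 : μ.real {ω | (cluster (R ω) b₀).Infinite} = 0 := by
    refine le_antisymm (ge_of_tendsto' (tendsto_pow_atTop_nhds_zero_of_lt_one (by positivity) hε)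
      hbound) measureReal_nonneg
  rw [measureReal_eq_zero_iff (measure_ne_top _ _)] at h0
  exact h0

end Cluster

/-! ### Integer coordinates on the body-centered lattice -/

section Coordinates

variable {d : ℕ}

/-- The even vertex with coordinates `2 x`. -/
def evenVertex (x : Fin d → ℤ) : BVertex d := ⟨fun i => 2 * x i, Or.inl fun i => by simp⟩

/-- The odd vertex with coordinates `2 y - 1`. -/
def oddVertex (y : Fin d → ℤ) : BVertex d :=
  ⟨fun i => 2 * y i - 1, Or.inr fun i => ⟨y i - 1, by ring⟩⟩

lemma evenVertex_injective : Function.Injective (evenVertex (d := d)) := fun x y h => by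
  ext i
  have := congrFun (congrArg Subtype.val h) i
  simp only [evenVertex] at this
  omega

lemma oddVertex_injective : Function.Injective (oddVertex (d := d)) := fun x y h => by
  ext i
  have := congrFun (congrArg Subtype.val h) i
  simp only [oddVertex] at this
  omega

lemma isEvenVertex_evenVertex (x : Fin d → ℤ) : IsEvenVertex (evenVertex x) :=
  fun i => ⟨x i, two_mul _⟩

lemma isOddVertex_oddVertex (y : Fin d → ℤ) : IsOddVertex (oddVertex y) :=
  fun i => ⟨y i - 1, by simp only [oddVertex]; ring⟩

lemma exists_eq_vertex (v : BVertex d) : (∃ x, v = evenVertex x) ∨ ∃ y, v = oddVertex y := by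
  obtain ⟨v, hv | hv⟩ := v
  · have hv' := hv
    choose x hx using hv'
    exact Or.inl ⟨x, Subtype.ext (funext fun i => by simp only [evenVertex, hx i]; ring)⟩
  · have hv' := hv
    choose y hy using hv'
    exact Or.inr ⟨fun i => y i + 1,
      Subtype.ext (funext fun i => by simp only [oddVertex, hy i]; ring)⟩

lemma evenVertex_ne_oddVertex [NeZero d] (x y : Fin d → ℤ) : evenVertex x ≠ oddVertex y := by
  intro h
  have := congrFun (congrArg Subtype.val h) 0
  simp only [evenVertex, oddVertex] at this
  omega

lemma norm_le_one_iff (f : Fin d → ℤ) : ‖f‖ ≤ 1 ↔ ∀ i, |f i| ≤ 1 := by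
  rw [pi_norm_le_iff_of_nonneg zero_le_one]
  refine forall_congr' fun i => ?_
  rw [Int.norm_eq_abs]
  exact_mod_cast Iff.rfl

lemma adj_evenVertex_oddVertex [NeZero d] (x y : Fin d → ℤ) :
    (bodyCenteredLattice d).Adj (evenVertex x) (oddVertex y) ↔ Touch x y := by
  change ‖(evenVertex x).1 - (oddVertex y).1‖ = 1 ↔ _
  have h1 : 1 ≤ ‖(evenVertex x).1 - (oddVertex y).1‖ := by
    refine le_trans ?_ (norm_le_pi_norm _ (0 : Fin d))
    rw [Int.norm_eq_abs]
    have : (1 : ℤ) ≤ |((evenVertex x).1 - (oddVertex y).1) 0| := by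
      refine Int.one_le_abs ?_
      simp only [evenVertex, oddVertex, Pi.sub_apply]
      omega
    exact_mod_cast this
  rw [← h1.ge_iff_eq', norm_le_one_iff]
  refine forall_congr' fun i => ?_
  rw [abs_le]
  simp only [evenVertex, oddVertex, Pi.sub_apply]
  omega

lemma norm_ne_one_of_even {f : Fin d → ℤ} (h : ∀ i, Even (f i)) : ‖f‖ ≠ 1 := by
  intro h1
  have h2 := (norm_le_one_iff f).mp h1.le
  have : f = 0 := by
    ext i
    obtain ⟨k, hk⟩ := h i
    have := abs_le.mp (h2 i)
    simp only [Pi.zero_apply]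
    omega
  simp [this] at h1

lemma not_adj_evenVertex (x x' : Fin d → ℤ) :
    ¬ (bodyCenteredLattice d).Adj (evenVertex x) (evenVertex x') :=
  norm_ne_one_of_even fun i => (isEvenVertex_evenVertex x i).sub (isEvenVertex_evenVertex x' i)

lemma not_adj_oddVertex (y y' : Fin d → ℤ) :
    ¬ (bodyCenteredLattice d).Adj (oddVertex y) (oddVertex y') :=
  norm_ne_one_of_even fun i => (isOddVertex_oddVertex y i).sub_odd (isOddVertex_oddVertex y' i)

end Coordinates

/-! ### From good sets to outcomes of the game -/

section Traps

variable {d : ℕ} [NeZero d] {ω : BVertex d → Bool} {A : Set (Fin d → ℤ)}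

/-- The configuration of the odd vertices. -/
def oddConfig (ω : BVertex d → Bool) : (Fin d → ℤ) → Bool := fun y => ω (oddVertex y)

/-- A good finite set of open even vertices is a trap. -/
lemma Good.exists_isTrap (hG : Good (oddConfig ω) A) (hA : A.Finite)
    (hopen : ∀ x ∈ A, ω (evenVertex x) = false) :
    ∃ (T : Finset {v : BVertex d // ω v = false}) (M : _ → _),
      IsTrap (openSubgraph (bodyCenteredLattice d) ω) T M ∧
      (∀ a ∈ T, ∃ x ∈ A, a.1 = evenVertex x) ∧
      ∀ o : {v : BVertex d // ω v = false}, ∀ y ∈ nbhd A, o.1 = oddVertex y →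
        ∃ a ∈ T, (openSubgraph (bodyCenteredLattice d) ω).Adj a o := by
  classical
  obtain ⟨M, hM, hinj⟩ := hG
  have hfin : {a : {v : BVertex d // ω v = false} | ∃ x ∈ A, a.1 = evenVertex x}.Finite := by
    refine Set.Finite.of_finite_image ((hA.image evenVertex).subset ?_)
      Subtype.val_injective.injOn
    rintro _ ⟨a, ⟨x, hx, hax⟩, rfl⟩
    exact ⟨x, hx, hax.symm⟩
  set T := hfin.toFinset with hT
  have hTmem : ∀ a, a ∈ T ↔ ∃ x ∈ A, a.1 = evenVertex x := fun a => by simp [hT]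
  have hN : ∀ o : {v : BVertex d // ω v = false},
      (∃ a ∈ T, (openSubgraph (bodyCenteredLattice d) ω).Adj a o) →
      ∃ y ∈ nbhd A, o.1 = oddVertex y := by
    rintro o ⟨a, ha, hao⟩
    obtain ⟨x, hx, hax⟩ := (hTmem a).mp ha
    have hao : (bodyCenteredLattice d).Adj a.1 o.1 := hao
    rw [hax] at hao
    rcases exists_eq_vertex o.1 with ⟨x', hx'⟩ | ⟨y, hy⟩
    · rw [hx'] at hao
      exact (not_adj_evenVertex _ _ hao).elim
    · rw [hy, adj_evenVertex_oddVertex] at hao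
      exact ⟨y, ⟨x, hx, hao⟩, hy⟩
  have hex : ∀ o : {v : BVertex d // ω v = false}, ∃ m : {v : BVertex d // ω v = false},
      ∀ y ∈ nbhd A, o.1 = oddVertex y → m.1 = evenVertex (M y) := by
    intro o
    by_cases h : ∃ y ∈ nbhd A, o.1 = oddVertex y
    · obtain ⟨y, hy, hoy⟩ := h
      refine ⟨⟨evenVertex (M y), hopen _ (hM y hy (by rw [oddConfig, ← hoy, o.2])).1⟩, ?_⟩
      intro z _ hoz
      obtain rfl := oddVertex_injective (hoy.symm.trans hoz)
      rfl
    · exact ⟨o, fun y hy hoy => (h ⟨y, hy, hoy⟩).elim⟩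
  choose K hK using hex
  have hC : ∀ (o : {v : BVertex d // ω v = false}) y, o.1 = oddVertex y →
      oddConfig ω y = false := fun o y hoy => by rw [oddConfig, ← hoy, o.2]
  refine ⟨T, K, ⟨fun o ho => ?_, fun o ho => ?_, fun o ho o' ho' hoo => ?_,
    fun a ha b hb hab => ?_⟩, fun a => (hTmem a).mp, fun o y hy hoy => ?_⟩
  · obtain ⟨y, hy, hoy⟩ := hN o ho
    exact (hTmem _).mpr ⟨M y, (hM y hy (hC o y hoy)).1, hK o y hy hoy⟩
  · obtain ⟨y, hy, hoy⟩ := hN o ho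
    change (bodyCenteredLattice d).Adj o.1 (K o).1
    rw [hoy, hK o y hy hoy]
    exact ((adj_evenVertex_oddVertex _ _).mpr (hM y hy (hC o y hoy)).2).symm
  · obtain ⟨y, hy, hoy⟩ := hN o ho
    obtain ⟨y', hy', hoy'⟩ := hN o' ho'
    have := congrArg Subtype.val hoo
    rw [hK o y hy hoy, hK o' y' hy' hoy'] at this
    refine Subtype.ext ?_
    rw [hoy, hoy', hinj ⟨hy, hC o y hoy⟩ ⟨hy', hC o' y' hoy'⟩ (evenVertex_injective this)]
  · obtain ⟨x, -, hx⟩ := (hTmem a).mp ha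
    obtain ⟨x', -, hx'⟩ := (hTmem b).mp hb
    have hab : (bodyCenteredLattice d).Adj a.1 b.1 := hab
    rw [hx, hx'] at hab
    exact not_adj_evenVertex _ _ hab
  · obtain ⟨x, hx, hxy⟩ := hy
    refine ⟨⟨evenVertex x, hopen x hx⟩, (hTmem _).mpr ⟨x, hx, rfl⟩, ?_⟩
    change (bodyCenteredLattice d).Adj (evenVertex x) o.1
    rw [hoy]
    exact (adj_evenVertex_oddVertex _ _).mpr hxy

lemma Good.openFirstWins (hG : Good (oddConfig ω) A) (hA : A.Finite)
    (hopen : ∀ x ∈ A, ω (evenVertex x) = false) {y : Fin d → ℤ} (hy : y ∈ nbhd A) :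
    OpenFirstWins (bodyCenteredLattice d) ω (oddVertex y) := by
  by_cases h : ω (oddVertex y) = true
  · exact Or.inl h
  rw [Bool.not_eq_true] at h
  obtain ⟨T, M, hT, hTA, hN⟩ := hG.exists_isTrap hA hopen
  have hF : Forced (openSubgraph (bodyCenteredLattice d) ω) (2 * T.card + 2) true
      (Position.start ⟨oddVertex y, h⟩) := by
    refine hT.forced_true (hN ⟨oddVertex y, h⟩ y hy rfl) (Set.mem_singleton _) fun a ha hav => ?_
    obtain ⟨x, -, hx⟩ := hTA a ha
    rw [Position.start, Set.mem_singleton_iff] at hav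
    rw [hav] at hx
    exact evenVertex_ne_oddVertex x y hx.symm
  exact Or.inr ⟨h, hF.firstWins⟩

/-- Every first move of Odin enters the neighbourhood of `A`. The initial vertex must lie outside
`A`, since the trap has to be unvisited when Eve starts to use it. -/
lemma Good.openSecondWins (hG : Good (oddConfig ω) A) (hA : A.Finite)
    (hopen : ∀ x ∈ A, ω (evenVertex x) = false) {x : Fin d → ℤ} (hx : ω (evenVertex x) = false)
    (hxA : x ∉ A) (hN : ∀ y, Touch x y → y ∈ nbhd A) :
    OpenSecondWins (bodyCenteredLattice d) ω (evenVertex x) := by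
  obtain ⟨T, M, hT, hTA, hTN⟩ := hG.exists_isTrap hA hopen
  refine ⟨hx, Forced.secondWins (n := 2 * T.card + 2 + 1) fun w hw => ?_⟩
  have hadj : (bodyCenteredLattice d).Adj (evenVertex x) w.1 := hw.1
  rcases exists_eq_vertex w.1 with ⟨x', hx'⟩ | ⟨y, hy⟩
  · rw [hx'] at hadj
    exact (not_adj_evenVertex _ _ hadj).elim
  rw [hy, adj_evenVertex_oddVertex] at hadj
  refine hT.forced_true (hTN w y (hN y hadj) hy) (by simp [Position.move]) fun a ha hav => ?_
  obtain ⟨z, hz, haz⟩ := hTA a ha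
  rcases hav with rfl | hav
  · exact evenVertex_ne_oddVertex z y (haz.symm.trans hy)
  · obtain rfl : a = ⟨evenVertex x, hx⟩ := hav
    exact hxA (evenVertex_injective haz ▸ hz)

/-- A finite region of even vertices which is surrounded by a trap contains no draws. -/
lemma Good.not_isDraw (hG : Good (oddConfig ω) A) (hA : A.Finite)
    (hopen : ∀ x ∈ A, ω (evenVertex x) = false) {R : Set (Fin d → ℤ)} (hR : R.Finite)
    (hRA : Disjoint R A)
    (hbd : ∀ x ∈ R, ∀ y, Touch x y → ∀ x', Touch x' y → x' ∈ R ∨ x' ∈ A) :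
    (∀ x ∈ R, ¬ IsDraw ω (evenVertex x)) ∧ ∀ y ∈ nbhd R, ¬ IsDraw ω (oddVertex y) := by
  classical
  obtain ⟨T, M, hT, hTA, hTN⟩ := hG.exists_isTrap hA hopen
  -- Odd vertices next to the trap count as exits, so that every even neighbour of a remaining odd
  -- vertex is in `R`.
  set I' : Set {v : BVertex d // ω v = false} := {v | (∃ x ∈ R, v.1 = evenVertex x) ∨
    ∃ y ∈ nbhd R, y ∉ nbhd A ∧ v.1 = oddVertex y} with hI'
  have hnf : (nbhd R).Finite := by
    refine (hR.biUnion fun x _ => Set.finite_Icc x (fun i => x i + 1)).subset ?_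
    rintro y ⟨x, hx, hxy⟩
    simp only [Set.mem_iUnion]
    exact ⟨x, hx, fun i => (hxy i).1, fun i => (hxy i).2⟩
  have hfin : I'.Finite := by
    refine Set.Finite.of_finite_image (((hR.image evenVertex).union
      (hnf.image oddVertex)).subset ?_) Subtype.val_injective.injOn
    rintro _ ⟨v, ⟨x, hx, hv⟩ | ⟨y, hy, -, hv⟩, rfl⟩
    · exact Or.inl ⟨x, hx, hv.symm⟩
    · exact Or.inr ⟨y, hy, hv.symm⟩
  have hdisj : Disjoint T hfin.toFinset := by
    rw [Finset.disjoint_left]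
    intro a ha haI
    obtain ⟨z, hz, haz⟩ := hTA a ha
    rcases hfin.mem_toFinset.mp haI with ⟨x, hx, hv⟩ | ⟨y, -, -, hv⟩
    · exact Set.disjoint_left.mp hRA hx (evenVertex_injective (hv.symm.trans haz) ▸ hz)
    · exact evenVertex_ne_oddVertex z y (haz.symm.trans hv)
  have hexit : ∀ v ∈ hfin.toFinset, ∀ w, (openSubgraph (bodyCenteredLattice d) ω).Adj v w →
      w ∈ hfin.toFinset ∨ ∃ a ∈ T, (openSubgraph (bodyCenteredLattice d) ω).Adj a w := by
    intro v hv w hvw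
    have hvw : (bodyCenteredLattice d).Adj v.1 w.1 := hvw
    rw [hfin.mem_toFinset] at hv ⊢
    rcases exists_eq_vertex w.1 with ⟨x', hw⟩ | ⟨y, hw⟩ <;>
      rcases hv with ⟨x, hx, hv⟩ | ⟨z, ⟨x, hx, hxz⟩, hzA, hv⟩ <;> rw [hv, hw] at hvw
    · exact (not_adj_evenVertex _ _ hvw).elim
    · have hvw := (adj_evenVertex_oddVertex _ _).mp hvw.symm
      refine Or.inl (Or.inl ⟨x', ?_, hw⟩)
      exact (hbd x hx z hxz x' hvw).resolve_right fun h => hzA ⟨x', h, hvw⟩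
    · rw [adj_evenVertex_oddVertex] at hvw
      by_cases hy : y ∈ nbhd A
      · exact Or.inr (hTN w y hy hw)
      · exact Or.inl (Or.inr ⟨y, ⟨x, hx, hvw⟩, hy, hw⟩)
    · exact (not_adj_oddVertex _ _ hvw).elim
  have key : ∀ v (h : ω v = false), (⟨v, h⟩ : {v : BVertex d // ω v = false}) ∈ I' →
      ¬ IsDraw ω v := by
    intro v h hv hdraw
    obtain ⟨b, hb⟩ := hT.determined hexit hdisj _ (Position.start ⟨v, h⟩)
      (hfin.mem_toFinset.mpr hv) (by simpa [Position.start] using hv) le_rfl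
    cases b with
    | true => exact hdraw.1 (Or.inr ⟨h, hb.firstWins⟩)
    | false => exact hdraw.2 ⟨h, hb.secondWins⟩
  refine ⟨fun x hx hdraw => ?_, fun y hy hdraw => ?_⟩
  · by_cases h : ω (evenVertex x) = true
    · exact hdraw.1 (Or.inl h)
    · exact key _ (Bool.not_eq_true _ ▸ h) (Or.inl ⟨x, hx, rfl⟩) hdraw
  · by_cases h : ω (oddVertex y) = true
    · exact hdraw.1 (Or.inl h)
    by_cases hyA : y ∈ nbhd A
    · exact hdraw.1 (hG.openFirstWins hA hopen hyA)
    · exact key _ (Bool.not_eq_true _ ▸ h) (Or.inr ⟨y, hy, hyA, rfl⟩) hdraw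

end Traps

/-! ### Closed even vertices absent: Eve wins -/

section Percolation

variable {d : ℕ} {p q : unitInterval}

instance (d : ℕ) (p q : unitInterval) : IsProbabilityMeasure (percolation d p q) := by
  unfold percolation; infer_instance

lemma iIndepFun_percolation :
    iIndepFun (fun (v : BVertex d) (ω : BVertex d → Bool) => ω v) (percolation d p q) :=
  iIndepFun_infinitePi (X := fun _ => id) fun _ => measurable_id

lemma percolation_closed (v : BVertex d) :
    (percolation d p q).real {ω | ω v = true} = closedProb p q v := by
  have h := measurePreserving_eval_infinitePi
    (fun v : BVertex d => bernoulliMeasure true false (closedProb p q v)) v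
  have h1 : (percolation d p q).real {ω | ω v = true} =
      (bernoulliMeasure true false (closedProb p q v)).real {true} :=
    congrArg ENNReal.toReal (h.measure_preimage (MeasurableSet.singleton true).nullMeasurableSet)
  rw [h1, bernoulliMeasure_real_apply_of_mem_of_notMem _ (MeasurableSet.singleton true) (by simp)
    (by simp)]

lemma closedProb_oddVertex (y : Fin d → ℤ) : closedProb p q (oddVertex y) = p :=
  if_pos (isOddVertex_oddVertex y)

lemma closedProb_evenVertex [NeZero d] (x : Fin d → ℤ) : closedProb p q (evenVertex x) = q :=
  if_neg fun h => Int.not_even_iff_odd.mpr (h 0) (isEvenVertex_evenVertex x 0)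

lemma indepClosed_oddVertex : IndepClosed (percolation d p q) p
    fun y (ω : BVertex d → Bool) => ω (oddVertex y) where
  meas _ := measurable_pi_apply _
  indep := iIndepFun_percolation.precomp oddVertex_injective
  le_prob y := by rw [percolation_closed, closedProb_oddVertex]

lemma cube_finite (a : Fin d → ℤ) (n : ℕ) : (Cube a n).Finite :=
  (Set.finite_Icc a (fun i => a i + n)).subset fun _ hx =>
    ⟨fun i => (hx i).1, fun i => (hx i).2.le⟩

/-- Failure of all sizes implies failure of each one, with probability at most `K / (n + 1)`. The
corner may vary with `n`, as the bound is uniform in position. -/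
lemma ae_exists_good_cube (hp : 0 < (p : ℝ)) (a : ℕ → Fin d → ℤ) :
    ∀ᵐ ω ∂percolation d p q, ∃ n, 0 < n ∧ Good (oddConfig ω) (Cube (a n) n) := by
  obtain ⟨K, hK, hgood⟩ := cubesLikelyGood d hp 1
  have h0 : (percolation d p q).real
      {ω | ¬ ∃ n, 0 < n ∧ Good (oddConfig ω) (Cube (a n) n)} = 0 := by
    refine le_antisymm (ge_of_tendsto (f := fun n : ℕ => K / ((n : ℝ) + 1))
      (x := Filter.atTop) ?_ ?_) measureReal_nonneg
    · exact Filter.Tendsto.const_div_atTop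
        (Filter.tendsto_atTop_add_const_right _ 1 tendsto_natCast_atTop_atTop) K
    · filter_upwards [Filter.eventually_gt_atTop 0] with n hn
      refine le_trans (measureReal_mono (fun ω hω hG => hω ⟨n, hn, hG⟩) (measure_ne_top _ _))
        ((hgood _ _ _ inferInstance _ indepClosed_oddVertex (a n) n).trans_eq (by rw [pow_one]))
  rw [measureReal_eq_zero_iff (measure_ne_top _ _)] at h0
  exact h0

lemma ae_evenVertex_open [NeZero d] :
    ∀ᵐ ω ∂percolation d p 0, ∀ x, ω (evenVertex x) = false := by
  refine ae_all_iff.mpr fun x => ?_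
  have h : (percolation d p 0).real {ω | ω (evenVertex x) = true} = 0 := by
    rw [percolation_closed, closedProb_evenVertex]
    rfl
  rw [measureReal_eq_zero_iff (measure_ne_top _ _)] at h
  rw [ae_iff]
  simpa using h

/-- The lower corner of a cube of side `n` which has `y` among its neighbours but does not
contain the vertex `x ≠ y` that touches `y`. -/
def awayCorner (x y : Fin d → ℤ) (n : ℕ) : Fin d → ℤ := fun i => if y i = x i then y i - n else y i

lemma mem_nbhd_awayCorner {x y : Fin d → ℤ} {n : ℕ} (hn : 0 < n) :
    y ∈ nbhd (Cube (awayCorner x y n) n) := by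
  rw [Cube, nbhd_box fun i => by omega, Set.mem_Icc, Pi.le_def, Pi.le_def]
  refine ⟨fun i => ?_, fun i => ?_⟩ <;> simp only [awayCorner] <;> split_ifs <;> omega

lemma notMem_awayCorner [NeZero d] {x y : Fin d → ℤ} (h : Touch x y) (n : ℕ) :
    x ∉ Cube (awayCorner x y n) n := by
  intro hx
  have h1 := hx 0
  have h2 := h 0
  simp only [awayCorner] at h1
  split_ifs at h1 <;> omega

lemma touch_self (y : Fin d → ℤ) : Touch y y := fun i => ⟨le_rfl, by omega⟩

/-- From an odd vertex one good cube adjacent to it suffices. From an even vertex `x`, each odd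
neighbour gets a good cube avoiding `x`, and the union of these finitely many cubes is the trap. -/
lemma ae_eveWins [NeZero d] (hp : 0 < (p : ℝ)) : ∀ᵐ ω ∂percolation d p 0, ∀ v, EveWins ω v := by
  have hcubes : ∀ᵐ ω ∂percolation d p 0, ∀ x y, ∃ n, 0 < n ∧
      Good (oddConfig ω) (Cube (awayCorner x y n) n) :=
    ae_all_iff.mpr fun x => ae_all_iff.mpr fun y => ae_exists_good_cube hp _
  filter_upwards [hcubes, ae_evenVertex_open] with ω hω hopen v
  choose n hn hG using hω
  rcases exists_eq_vertex v with ⟨x, rfl⟩ | ⟨y, rfl⟩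
  · have htouch : ∀ y, y ∈ Finset.Icc x (fun i => x i + 1) ↔ Touch x y := fun y => by
      rw [Finset.mem_Icc, Pi.le_def, Pi.le_def, ← forall_and]
      rfl
    refine Or.inr ⟨isEvenVertex_evenVertex x, Good.openSecondWins
      (Good.biUnion (Finset.Icc x (fun i => x i + 1)) fun y _ => hG x y)
      ((Finset.finite_toSet _).biUnion fun y _ => cube_finite _ _)
      (fun x _ => hopen x) (hopen x) (fun hx => ?_) fun y hy => ?_⟩
    · simp only [Set.mem_iUnion] at hx
      obtain ⟨y, hy, hx⟩ := hx
      exact notMem_awayCorner ((htouch y).mp hy) _ hx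
    · obtain ⟨z, hz, hzy⟩ := mem_nbhd_awayCorner (x := x) (y := y) (hn x y)
      simp only [nbhd, Set.mem_iUnion]
      exact ⟨z, ⟨y, (htouch y).mpr hy, hz⟩, hzy⟩
  · exact Or.inl ⟨isOddVertex_oddVertex y, (hG y y).openFirstWins (cube_finite _ _)
      (fun x _ => hopen x) (mem_nbhd_awayCorner (hn y y))⟩

end Percolation

/-! ### Few closed even vertices: block renormalization -/

section Blocks

variable {d : ℕ} {p q : unitInterval}

/-- The lower corner of the block with index `b`. -/
def blockCorner (n : ℕ) (b : Fin d → ℤ) : Fin d → ℤ := fun i => n * b i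

lemma mem_block_iff {n : ℕ} (hn : 0 < n) {b x : Fin d → ℤ} :
    x ∈ Cube (blockCorner n b) n ↔ (fun i => x i / (n : ℤ)) = b := by
  have hn' : (0 : ℤ) < n := by exact_mod_cast hn
  rw [funext_iff]
  refine forall_congr' fun i => ?_
  rw [Int.ediv_eq_iff_of_pos hn']
  simp only [blockCorner]
  constructor <;> rintro ⟨h1, h2⟩ <;> constructor <;> nlinarith

/-- The block with index `b` is bad: its even vertices do not form a trap. -/
def BadBlock (n : ℕ) (b : Fin d → ℤ) (ω : BVertex d → Bool) : Prop :=
  ¬ (Good (oddConfig ω) (Cube (blockCorner n b) n) ∧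
    ∀ x ∈ Finset.Icc (blockCorner n b) (fun i => blockCorner n b i + n), ω (evenVertex x) = false)

open Classical in
/-- The vertices that determine whether a block is bad. -/
noncomputable def blockSupport (n : ℕ) (b : Fin d → ℤ) : Finset (BVertex d) :=
  (Finset.Icc (blockCorner n b) (fun i => blockCorner n b i + n)).image oddVertex ∪
    (Finset.Icc (blockCorner n b) (fun i => blockCorner n b i + n)).image evenVertex

lemma dependsOn_badBlock (n : ℕ) (b : Fin d → ℤ) :
    DependsOn (BadBlock n b) (blockSupport n b : Set (BVertex d)) := by
  classical
  intro ω ω' h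
  refine propext (not_congr (and_congr ?_ (forall₂_congr fun x hx => ?_)))
  · refine (dependsOn_good_cube (blockCorner n b) n fun y hy => h _ ?_).to_iff
    exact Finset.mem_coe.mpr
      (Finset.mem_union_left _ (Finset.mem_image_of_mem _ (Finset.mem_coe.mp hy)))
  · rw [h _ (Finset.mem_coe.mpr (Finset.mem_union_right _ (Finset.mem_image_of_mem _ hx)))]

lemma exists_mem_Icc_of_mem_blockSupport {n : ℕ} {b : Fin d → ℤ} {v : BVertex d}
    (hv : v ∈ blockSupport n b) :
    ∀ i, 2 * (n * b i) - 1 ≤ v.1 i ∧ v.1 i ≤ 2 * (n * b i + n) := by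
  classical
  intro i
  rcases Finset.mem_union.mp hv with hv | hv <;>
    obtain ⟨x, hx, rfl⟩ := Finset.mem_image.mp hv <;> rw [Finset.mem_Icc] at hx <;>
    have h1 := hx.1 i <;> have h2 := hx.2 i <;>
    simp only [blockCorner, oddVertex, evenVertex] at h1 h2 ⊢ <;> omega

/-- Neighbouring blocks share odd vertices on their common face, but distinct indices with even
differences are at least two apart in some coordinate. -/
lemma disjoint_blockSupport {n : ℕ} (hn : 0 < n) {b b' : Fin d → ℤ} (hne : b ≠ b')
    (h : ∀ i, (2 : ℤ) ∣ b i - b' i) : Disjoint (blockSupport n b) (blockSupport n b') := by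
  rw [Finset.disjoint_left]
  intro v hv hv'
  obtain ⟨i, hi⟩ := Function.ne_iff.mp hne
  have h1 := exists_mem_Icc_of_mem_blockSupport hv i
  have h2 := exists_mem_Icc_of_mem_blockSupport hv' i
  have hn' : (1 : ℤ) ≤ n := by exact_mod_cast hn
  have h3 := h i
  rcases lt_or_gt_of_ne hi with hlt | hlt
  · have : b i + 2 ≤ b' i := by omega
    nlinarith
  · have : b' i + 2 ≤ b i := by omega
    nlinarith

lemma exists_badBlock_le [NeZero d] (hp : 0 < (p : ℝ)) {ε : ℝ} (hε : 0 < ε) :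
    ∃ n : ℕ, 0 < n ∧ ∃ q₀ : ℝ, 0 < q₀ ∧ ∀ q : unitInterval, (q : ℝ) < q₀ → ∀ b : Fin d → ℤ,
      (percolation d p q).real {ω | BadBlock n b ω} ≤ ε := by
  obtain ⟨K, hK, hgood⟩ := cubesLikelyGood d hp 1
  obtain ⟨n, hn⟩ := exists_nat_gt (max 0 (2 * K / ε))
  have hn0 : (0 : ℝ) < n := (le_max_left _ _).trans_lt hn
  have hn1 := (le_max_right _ _).trans_lt hn
  rw [div_lt_iff₀ hε] at hn1
  -- Half of `ε` covers the failure of matching, made small by `n`; the other half covers a closed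
  -- vertex among the `(n + 1) ^ d` even ones inspected.
  refine ⟨n, by exact_mod_cast hn0, ε / (2 * (n + 1) ^ d), by positivity, fun q hq b => ?_⟩
  rw [lt_div_iff₀ (by positivity)] at hq
  have hsub : {ω | BadBlock n b ω} ⊆ {ω | ¬ Good (oddConfig ω) (Cube (blockCorner n b) n)} ∪
      ⋃ x ∈ Finset.Icc (blockCorner n b) (fun i => blockCorner n b i + n),
        {ω | ω (evenVertex x) = true} := by
    intro ω hω
    by_contra hcon
    refine hω ⟨by_contra fun h => hcon (Or.inl h), fun x hx => by_contra fun h =>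
      hcon (Or.inr ?_)⟩
    simp only [Set.mem_iUnion]
    exact ⟨x, hx, by simpa using h⟩
  refine (measureReal_mono hsub (measure_ne_top _ _)).trans ((measureReal_union_le _ _).trans ?_)
  have h1 := (hgood _ _ (percolation d p q) inferInstance _ indepClosed_oddVertex
    (blockCorner n b) n)
  have h2 : (percolation d p q).real
      (⋃ x ∈ Finset.Icc (blockCorner n b) (fun i => blockCorner n b i + n),
        {ω | ω (evenVertex x) = true}) ≤ (n + 1) ^ d * q := by
    refine (measureReal_biUnion_finset_le _ _).trans_eq ?_
    simp_rw [percolation_closed, closedProb_evenVertex]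
    rw [Finset.sum_const, card_Icc_cube, nsmul_eq_mul]
    push_cast
    rfl
  have h3 : K / ((n : ℝ) + 1) ^ 1 ≤ ε / 2 := by
    rw [pow_one, div_le_div_iff₀ (by positivity) (by norm_num)]
    nlinarith
  have h4 : ((n : ℝ) + 1) ^ d * q ≤ ε / 2 := by linarith
  have h5 := add_le_add (h1.trans h3) (h2.trans h4)
  rw [add_halves] at h5
  exact h5

lemma measure_forall_badBlock_le {n : ℕ} (hn : 0 < n) {ε : ℝ}
    (hε : ∀ b : Fin d → ℤ, (percolation d p q).real {ω | BadBlock n b ω} ≤ ε)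
    (T : Finset (Fin d → ℤ)) (hT : ∀ b ∈ T, ∀ b' ∈ T, ∀ i, (2 : ℤ) ∣ b i - b' i) :
    (percolation d p q).real {ω | ∀ b ∈ T, BadBlock n b ω} ≤ ε ^ T.card := by
  have h := measure_forall_of_dependsOn (μ := percolation d p q)
    (c := fun v (ω : BVertex d → Bool) => ω v) (fun v => measurable_pi_apply v)
    iIndepFun_percolation T (F := BadBlock n) (S := blockSupport n)
    (fun b hb b' hb' hne => disjoint_blockSupport hn hne (hT b hb b' hb'))
    (fun b _ => dependsOn_badBlock n b)
  rw [← Finset.prod_const]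
  exact h.trans_le (Finset.prod_le_prod (fun _ _ => measureReal_nonneg) fun b _ => hε b)

lemma ae_finite_badBlock_cluster {n : ℕ} (hn : 0 < n) {ε : ℝ} (hε0 : 0 ≤ ε) (hε1 : ε ≤ 1)
    (hε2 : ((3 ^ d) ^ 2 ^ d : ℕ) * ε < 1)
    (hε : ∀ b : Fin d → ℤ, (percolation d p q).real {ω | BadBlock n b ω} ≤ ε) :
    ∀ᵐ ω ∂percolation d p q, ∀ b₀, (cluster (fun b => BadBlock n b ω) b₀).Finite :=
  ae_all_iff.mpr fun b₀ => ae_finite_cluster (R := fun ω b => BadBlock n b ω) hε0 hε1 hε2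
    (fun T hT => measure_forall_badBlock_le hn hε T hT) b₀

lemma finite_near {D : Set (Fin d → ℤ)} (hD : D.Finite) : {b | ∃ b' ∈ D, Near b' b}.Finite := by
  refine (hD.biUnion fun b' _ =>
    Set.finite_Icc (fun i => b' i - 1) (fun i => b' i + 1)).subset ?_
  rintro b ⟨b', hb', hb⟩
  simp only [Set.mem_iUnion]
  refine ⟨b', hb', ?_⟩
  rw [Set.mem_Icc, Pi.le_def, Pi.le_def]
  refine ⟨fun i => ?_, fun i => ?_⟩ <;> have := abs_le.mp (hb i) <;> omega

lemma near_block {n : ℕ} (hn : 0 < n) {x x' y : Fin d → ℤ} (h : Touch x y) (h' : Touch x' y) :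
    Near (fun i => x i / (n : ℤ)) (fun i => x' i / (n : ℤ)) := by
  have hn' : (0 : ℤ) < n := by exact_mod_cast hn
  intro i
  have h1 := h i
  have h2 := h' i
  have key : ∀ s t : ℤ, s ≤ t + 1 → s / n ≤ t / n + 1 := fun s t hst => by
    refine (Int.ediv_le_ediv hn' (hst.trans (by omega : t + 1 ≤ t + n))).trans_eq ?_
    rw [Int.add_ediv_of_dvd_right (dvd_refl _), Int.ediv_self hn'.ne']
  have h3 := key (x i) (x' i) (by omega)
  have h4 := key (x' i) (x i) (by omega)
  rw [abs_le]
  dsimp only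
  omega

/-- A block near the cluster but outside it is not bad, since otherwise the cluster would extend to
it. These blocks form the surrounding trap, and even vertices with a common odd neighbour lie in
near blocks, so the region has no other exit. -/
lemma not_isDraw_of_finite_cluster [NeZero d] {n : ℕ} (hn : 0 < n) {ω : BVertex d → Bool}
    (hfin : ∀ b₀, (cluster (fun b => BadBlock n b ω) b₀).Finite) (v : BVertex d) :
    ¬ IsDraw ω v := by
  obtain ⟨x₀, hx₀⟩ : ∃ x₀, v = evenVertex x₀ ∨ v = oddVertex x₀ := by
    rcases exists_eq_vertex v with ⟨x, h⟩ | ⟨y, h⟩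
    exacts [⟨x, Or.inl h⟩, ⟨y, Or.inr h⟩]
  set b₀ : Fin d → ℤ := fun i => x₀ i / (n : ℤ) with hb₀
  set D := cluster (fun b => BadBlock n b ω) b₀ with hD
  have hDfin : D.Finite := hfin b₀
  have hb₀D : b₀ ∈ D := Relation.ReflTransGen.refl
  have hBfin : ({b | ∃ b' ∈ D, Near b' b} \ D).Finite := (finite_near hDfin).sdiff
  set T := hBfin.toFinset with hT
  have hTmem : ∀ b, b ∈ T ↔ (∃ b' ∈ D, Near b' b) ∧ b ∉ D := fun b => by simp [hT]
  have hTgood : ∀ b ∈ T, Good (oddConfig ω) (Cube (blockCorner n b) n) ∧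
      ∀ x ∈ Finset.Icc (blockCorner n b) (fun i => blockCorner n b i + n),
        ω (evenVertex x) = false := by
    intro b hb
    obtain ⟨⟨b', hb', hbb'⟩, hbD⟩ := (hTmem b).mp hb
    by_contra hbad
    exact hbD (Relation.ReflTransGen.tail hb' ⟨hbb', hbad⟩)
  have hmemA : ∀ x, x ∈ ⋃ b ∈ T, Cube (blockCorner n b) n ↔ (fun i => x i / (n : ℤ)) ∈ T := by
    intro x
    simp [mem_block_iff hn]
  have hopen : ∀ x ∈ ⋃ b ∈ T, Cube (blockCorner n b) n, ω (evenVertex x) = false := by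
    intro x hx
    simp only [Set.mem_iUnion] at hx
    obtain ⟨b, hb, hx⟩ := hx
    exact (hTgood b hb).2 x (Finset.mem_Icc.mpr ⟨fun i => (hx i).1, fun i => (hx i).2.le⟩)
  have hmemR : ∀ x, x ∈ ⋃ b ∈ D, Cube (blockCorner n b) n ↔ (fun i => x i / (n : ℤ)) ∈ D := by
    intro x
    simp [mem_block_iff hn]
  have key := (Good.biUnion T fun b hb => (hTgood b hb).1).not_isDraw
    (T.finite_toSet.biUnion fun b _ => cube_finite _ _) hopen
    (R := ⋃ b ∈ D, Cube (blockCorner n b) n) (hDfin.biUnion fun b _ => cube_finite _ _)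
    (Set.disjoint_left.mpr fun x hx hxA => by
      rw [hmemR] at hx
      rw [hmemA, hTmem] at hxA
      exact hxA.2 hx)
    (fun x hx y hxy x' hxy' => by
      rw [hmemR] at hx
      rw [hmemR, hmemA, hTmem]
      by_cases h : (fun i => x' i / (n : ℤ)) ∈ D
      · exact Or.inl h
      · exact Or.inr ⟨⟨_, hx, near_block hn hxy hxy'⟩, h⟩)
  have hx₀R : x₀ ∈ ⋃ b ∈ D, Cube (blockCorner n b) n := (hmemR x₀).mpr hb₀D
  rcases hx₀ with rfl | rfl
  · exact key.1 x₀ hx₀R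
  · exact key.2 x₀ ⟨x₀, hx₀R, touch_self x₀⟩

end Blocks

end Trap

theorem mainTheorem1 (d : ℕ) (hd : 2 ≤ d) (p : unitInterval) (hp : 0 < (p : ℝ)) :
    (∀ᵐ ω ∂(Trap.percolation d p 0), ∀ v : Trap.BVertex d, Trap.EveWins ω v) ∧
    (∃ q₀ : ℝ, 0 < q₀ ∧ ∀ q : unitInterval, (q : ℝ) < q₀ →
      ∀ᵐ ω ∂(Trap.percolation d p q), ∀ v : Trap.BVertex d, ¬ Trap.IsDraw ω v) := by
  have : NeZero d := ⟨by omega⟩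
  refine ⟨Trap.ae_eveWins hp, ?_⟩
  have hN : (1 : ℝ) ≤ (((3 ^ d) ^ 2 ^ d : ℕ) : ℝ) := by
    exact_mod_cast Nat.one_le_iff_ne_zero.mpr (by simp)
  set N : ℝ := (((3 ^ d) ^ 2 ^ d : ℕ) : ℝ)
  -- With `N` the number of step sequences of length `2 ^ d`, this makes the ratio in the path count
  -- equal to `1 / 2`.
  have hε0 : 0 < 1 / (2 * N) := by positivity
  have hε2 : N * (1 / (2 * N)) < 1 := by
    have : N * (1 / (2 * N)) = 1 / 2 := by field_simp
    rw [this]; norm_num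
  obtain ⟨n, hn, q₀, hq₀, hbad⟩ := Trap.exists_badBlock_le (d := d) hp hε0
  refine ⟨q₀, hq₀, fun q hq => ?_⟩
  filter_upwards [Trap.ae_finite_badBlock_cluster hn hε0.le (by nlinarith) hε2 (hbad q hq)]
    with ω hω v
  exact Trap.not_isDraw_of_finite_cluster hn hω v
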